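/- Let $G$ be a finite simple graph whose vertex set $I$ has $n$ elements and is totally ordered. Let $\pi^G(q)$ be its chromatic polynomial (for every natural number $m$, $\pi^G(m)$ is the number of proper vertex colorings of $G$ with $m$ colors), and let $\widetilde\pi^G(q) = (-1)^n\,\pi^G(-q)$ be the sign-adjusted chromatic polynomial. Two elements of $I$ are called concurrent if they are equal or adjacent. A pre-heap over $G$ is a finite set $E$ of pieces $(\alpha,i)\in I\times\{0,1,2,\dots\}$ in which distinct pieces with concurrent positions $\alpha$ have distinct levels $i$. A heap is a pre-heap in which every piece $(\alpha,i)$ with $i>0$ has a piece $(\beta,i-1)\in E$ with $\beta$ concurrent to $\alpha$. The superposition $E\circ F$ is the heap obtained by placing $F$ above $E$ and letting the pieces fall as far as the concurrent pieces below them allow. The standard word of $E$ is the lexicographically greatest word $p_1p_2\cdots p_k$ in $I$ with $E=p_1\circ p_2\circ\cdots\circ p_k$, and $E\le F$ means that the standard word of $E$ is lexicographically at most that of $F$. A heap $E$ is primitive if $E=U\circ V=V\circ U$ implies that $U$ or $V$ is empty. Conjugacy is the transitive closure of the relation $U\circ V\sim V\circ U$. A heap is Lyndon if it is non-empty, primitive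 and minimal in its conjugacy class. A Lyndon factorization of $E$ is $E=L_1\circ\cdots\circ L_k$ with $k\ge 0$, all $L_i$ Lyndon and $L_1\ge\cdots\ge L_k$. Let $\mathcal H_{\mathbf 1}$ be the finite set of multilinear heaps over $G$, that is, those with exactly one piece in every position $\alpha\in I$. Then every $E\in\mathcal H_{\mathbf 1}$ has a unique Lyndon factorization; let the Lyndon length $ll(E)$ be its number of factors. Moreover, $$\widetilde\pi^G(q)=\sum_{E\in\mathcal H_{\mathbf 1}} q^{\,ll(E)},$$ and, if $I\neq\emptyset$, also $$\widetilde\pi^G(q)=\sum_{k\ge 1}\bigl|\{E\in\mathcal H_{\mathbf 1} : ll(E)=k\}\bigr|\,q^k .$$ -/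

import Mathlib

/-! ### The chromatic polynomial -/

/-- There is exactly one integer polynomial whose value at every natural number `m` is the
number of proper vertex colorings of `G` with `m` colors. -/
theorem existsUnique_chromaticPolynomial {I : Type*} [Finite I] (G : SimpleGraph I) :
    ∃! P : Polynomial ℤ, ∀ m : ℕ, P.eval (m : ℤ) = (Nat.card (G.Coloring (Fin m)) : ℤ) := by
  classical
  have : Fintype I := Fintype.ofFinite I
  have hS : Finite (Setoid I) := Finite.of_injective (fun r : Setoid I => fun a b => r a b) (by
    intro r s h
    ext a b
    exact iff_of_eq (congrFun (congrFun h a) b))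
  have : Fintype (Setoid I) := Fintype.ofFinite _
  obtain ⟨P, hP⟩ : ∃ P : Polynomial ℤ, ∀ m : ℕ,
      P.eval (m : ℤ) = (Nat.card (G.Coloring (Fin m)) : ℤ) := by
    refine ⟨∑ r : {r : Setoid I // ∀ a b, G.Adj a b → ¬ r a b},
      descPochhammer ℤ (Fintype.card (Quotient r.1)), ?_⟩
    intro m
    have e : G.Coloring (Fin m) ≃
        Σ r : {r : Setoid I // ∀ a b, G.Adj a b → ¬ r a b}, (Quotient r.1 ↪ Fin m) :=
      { toFun := fun c => ⟨⟨Setoid.ker c, fun a b h hk => c.valid h hk⟩,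
          ⟨Quotient.lift c (fun _ _ h => h), by
            intro x y
            induction x using Quotient.inductionOn
            induction y using Quotient.inductionOn
            intro h
            exact Quotient.sound h⟩⟩
        invFun := fun p => SimpleGraph.Coloring.mk (fun a => p.2 (Quotient.mk _ a)) (by
          intro a b h hk
          exact p.1.2 a b h (Quotient.exact (p.2.injective hk)))
        left_inv := by
          intro c
          ext a
          rfl
        right_inv := by
          rintro ⟨⟨r, hr⟩, f⟩
          have hk : ∀ a b, f (Quotient.mk r a) = f (Quotient.mk r b) ↔ r a b := fun a b =>
            ⟨fun h => Quotient.exact (f.injective h), fun h => by rw [Quotient.sound h]⟩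
          have hr' : Setoid.ker (fun a => f (Quotient.mk r a)) = r := by
            ext a b
            exact hk a b
          have key : ∀ (s : Setoid I) (hs : ∀ a b, G.Adj a b → ¬ s a b)
              (g : Quotient s ↪ Fin m), s = r →
              (∀ a, g (Quotient.mk s a) = f (Quotient.mk r a)) →
              (⟨⟨s, hs⟩, g⟩ : Σ r : {r : Setoid I // ∀ a b, G.Adj a b → ¬ r a b},
                (Quotient r.1 ↪ Fin m)) = ⟨⟨r, hr⟩, f⟩ := by
            intro s hs g hsr hg
            subst hsr
            congr 1
            ext x
            induction x using Quotient.inductionOn with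
            | h a => rw [hg a]
          exact key _ _ _ hr' (fun a => rfl) }
    rw [Nat.card_congr e, Nat.card_eq_fintype_card, Fintype.card_sigma, Polynomial.eval_finsetSum,
      Nat.cast_sum]
    refine Finset.sum_congr rfl fun r _ => ?_
    rw [descPochhammer_eval_eq_descFactorial, Fintype.card_embedding_eq, Fintype.card_fin]
  refine ⟨P, hP, fun Q hQ => Polynomial.eq_of_infinite_eval_eq _ _ ?_⟩
  refine (Set.infinite_range_of_injective (Nat.cast_injective (R := ℤ))).mono ?_
  rintro _ ⟨m, rfl⟩
  exact (hQ m).trans (hP m).symm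

/-- The chromatic polynomial of `G`: the polynomial that counts, at every natural number `m`, the
proper vertex colorings of `G` with `m` colors. -/
noncomputable def chromaticPolynomial {I : Type*} [Finite I] (G : SimpleGraph I) :
    Polynomial ℤ :=
  (existsUnique_chromaticPolynomial G).choose

theorem chromaticPolynomial_eval {I : Type*} [Finite I] (G : SimpleGraph I) (m : ℕ) :
    (chromaticPolynomial G).eval (m : ℤ) = (Nat.card (G.Coloring (Fin m)) : ℤ) :=
  (existsUnique_chromaticPolynomial G).choose_spec.1 m

/-- The sign-adjusted chromatic polynomial `(-1) ^ n * π (-q)`, `n` the number of vertices. -/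
noncomputable def signedChromaticPolynomial {I : Type*} [Finite I] (G : SimpleGraph I) :
    Polynomial ℤ :=
  (-1) ^ Nat.card I * (chromaticPolynomial G).comp (-Polynomial.X)

/-! ### Heaps of pieces over a graph -/

/-- The concurrency relation `ζ`: two positions are concurrent if they are equal or adjacent. -/
def Concurrent {I : Type*} (G : SimpleGraph I) (a b : I) : Prop :=
  a = b ∨ G.Adj a b

/-- A pre-heap: a finite set of pieces (position, level) in which different pieces with
concurrent positions have different levels. -/
def IsPreHeap {I : Type*} (G : SimpleGraph I) (P : Finset (I × ℕ)) : Prop :=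
  ∀ p ∈ P, ∀ q ∈ P, p ≠ q → Concurrent G p.1 q.1 → p.2 ≠ q.2

/-- A heap: a pre-heap in which every piece of positive level lies on a concurrent piece exactly
one level below. -/
@[ext]
structure Heap {I : Type*} (G : SimpleGraph I) where
  pieces : Finset (I × ℕ)
  isPreHeap : IsPreHeap G pieces
  supported : ∀ p ∈ pieces, 0 < p.2 →
    ∃ q ∈ pieces, q.2 + 1 = p.2 ∧ Concurrent G q.1 p.1

open Classical in
/-- The level that the piece `p` reaches when all the pieces of `P` fall: the least level above
the final levels of all the pieces of `P` that are concurrent to `p` and lie below `p`. -/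
noncomputable def fallLevel {I : Type*} (G : SimpleGraph I) (P : Finset (I × ℕ))
    (p : I × ℕ) : ℕ :=
  (P.filter (fun q => q.2 < p.2 ∧ Concurrent G q.1 p.1)).attach.sup
    (fun q => fallLevel G P q.1 + 1)
termination_by p.2
decreasing_by exact (Finset.mem_filter.mp q.2).2.1

open Classical in
theorem fallLevel_eq {I : Type*} (G : SimpleGraph I) (P : Finset (I × ℕ)) (p : I × ℕ) :
    fallLevel G P p = (P.filter (fun q => q.2 < p.2 ∧ Concurrent G q.1 p.1)).sup
      (fun q => fallLevel G P q + 1) := by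
  rw [fallLevel]
  exact Finset.sup_attach _ (fun q => fallLevel G P q + 1)

theorem fallLevel_lt {I : Type*} (G : SimpleGraph I) (P : Finset (I × ℕ)) {p q : I × ℕ}
    (hq : q ∈ P) (hlt : q.2 < p.2) (hc : Concurrent G q.1 p.1) :
    fallLevel G P q < fallLevel G P p := by
  classical
  rw [fallLevel_eq G P p, Nat.lt_iff_add_one_le]
  exact Finset.le_sup (f := fun q => fallLevel G P q + 1)
    (Finset.mem_filter.mpr ⟨hq, hlt, hc⟩)

theorem Concurrent.symm {I : Type*} {G : SimpleGraph I} {a b : I} (h : Concurrent G a b) :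
    Concurrent G b a :=
  h.imp Eq.symm G.adj_symm

theorem fallLevel_ne {I : Type*} {G : SimpleGraph I} {P : Finset (I × ℕ)} (hP : IsPreHeap G P)
    {p q : I × ℕ} (hp : p ∈ P) (hq : q ∈ P) (hne : p ≠ q) (hc : Concurrent G p.1 q.1) :
    fallLevel G P p ≠ fallLevel G P q := by
  rcases lt_or_gt_of_ne (hP p hp q hq hne hc) with h | h
  · exact (fallLevel_lt G P hp h hc).ne
  · exact (fallLevel_lt G P hq h hc.symm).ne'

theorem exists_fallLevel {I : Type*} (G : SimpleGraph I) (P : Finset (I × ℕ)) (p : I × ℕ)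
    (h : 0 < fallLevel G P p) :
    ∃ q ∈ P, fallLevel G P q + 1 = fallLevel G P p ∧ Concurrent G q.1 p.1 := by
  classical
  rw [fallLevel_eq] at h
  have hne : (P.filter (fun q => q.2 < p.2 ∧ Concurrent G q.1 p.1)).Nonempty := by
    rw [Finset.nonempty_iff_ne_empty]
    intro h0
    rw [h0] at h
    simp at h
  obtain ⟨q, hq, he⟩ := Finset.exists_mem_eq_sup _ hne (fun q => fallLevel G P q + 1)
  have hq' := Finset.mem_filter.mp hq
  exact ⟨q, hq'.1, by rw [fallLevel_eq G P p, he], hq'.2.2⟩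

namespace Heap

/-- The heap obtained from a pre-heap by letting its pieces fall. -/
noncomputable def settle {I : Type*} [DecidableEq I] (G : SimpleGraph I) (P : Finset (I × ℕ))
    (hP : IsPreHeap G P) : Heap G where
  pieces := P.image (fun p => (p.1, fallLevel G P p))
  isPreHeap := by
    intro x hx y hy hne hc
    obtain ⟨p, hp, rfl⟩ := Finset.mem_image.mp hx
    obtain ⟨q, hq, rfl⟩ := Finset.mem_image.mp hy
    exact fallLevel_ne hP hp hq (fun h => hne (by rw [h])) hc
  supported := by
    intro x hx h
    obtain ⟨p, hp, rfl⟩ := Finset.mem_image.mp hx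
    obtain ⟨q, hq, he, hc⟩ := exists_fallLevel G P p h
    exact ⟨_, Finset.mem_image_of_mem _ hq, he, hc⟩

/-- The number of levels of a heap, one more than the highest level of a piece. -/
def height {I : Type*} {G : SimpleGraph I} (E : Heap G) : ℕ :=
  E.pieces.sup (fun p => p.2 + 1)

/-- The pieces of `E`, with the pieces of `F` placed above all of them. -/
def stack {I : Type*} [DecidableEq I] {G : SimpleGraph I} (E F : Heap G) : Finset (I × ℕ) :=
  E.pieces ∪ F.pieces.image (fun p => (p.1, p.2 + E.height))

theorem lt_height {I : Type*} {G : SimpleGraph I} (E : Heap G) {p : I × ℕ}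
    (hp : p ∈ E.pieces) : p.2 < E.height :=
  Nat.lt_iff_add_one_le.mpr (Finset.le_sup (f := fun p : I × ℕ => p.2 + 1) hp)

theorem isPreHeap_stack {I : Type*} [DecidableEq I] {G : SimpleGraph I} (E F : Heap G) :
    IsPreHeap G (stack E F) := by
  intro x hx y hy hne hc
  rcases Finset.mem_union.mp hx with hx | hx <;> rcases Finset.mem_union.mp hy with hy | hy
  · exact E.isPreHeap x hx y hy hne hc
  · obtain ⟨q, hq, rfl⟩ := Finset.mem_image.mp hy
    have := E.lt_height hx
    simp only
    omega
  · obtain ⟨q, hq, rfl⟩ := Finset.mem_image.mp hx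
    have := E.lt_height hy
    simp only
    omega
  · obtain ⟨p, hp, rfl⟩ := Finset.mem_image.mp hx
    obtain ⟨q, hq, rfl⟩ := Finset.mem_image.mp hy
    have := F.isPreHeap p hp q hq (fun h => hne (by rw [h])) hc
    simp only
    omega

/-- The superposition `E ∘ F`: the heap `F` falls over `E`. -/
noncomputable def superpose {I : Type*} [DecidableEq I] {G : SimpleGraph I} (E F : Heap G) :
    Heap G :=
  settle G (stack E F) (isPreHeap_stack E F)

/-- The empty heap. -/
def empty {I : Type*} (G : SimpleGraph I) : Heap G where
  pieces := ∅
  isPreHeap := by simp [IsPreHeap]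
  supported := by simp

/-- The heap with a single piece, in position `a`. -/
def single {I : Type*} (G : SimpleGraph I) (a : I) : Heap G where
  pieces := {(a, 0)}
  isPreHeap := by simp [IsPreHeap]
  supported := by simp

/-- The superposition `L₁ ∘ L₂ ∘ ⋯ ∘ Lₖ` of a list of heaps (the empty heap if `k = 0`). -/
noncomputable def prod {I : Type*} [DecidableEq I] {G : SimpleGraph I} (L : List (Heap G)) :
    Heap G :=
  L.foldl superpose (empty G)

/-- The heap `p₁ ∘ p₂ ∘ ⋯ ∘ pₖ` of a word `p₁ p₂ ⋯ pₖ` in the positions. -/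
noncomputable def ofWord {I : Type*} [DecidableEq I] (G : SimpleGraph I) (w : List I) : Heap G :=
  prod (w.map (single G))

theorem card_superpose {I : Type*} [DecidableEq I] {G : SimpleGraph I} (E F : Heap G) :
    (superpose E F).pieces.card = E.pieces.card + F.pieces.card := by
  have h1 : (superpose E F).pieces.card = (stack E F).card := by
    refine Finset.card_image_of_injOn ?_
    intro p hp q hq h
    by_contra hne
    simp only [Prod.mk.injEq] at h
    exact fallLevel_ne (isPreHeap_stack E F) hp hq hne (Or.inl h.1) h.2
  rw [h1, stack, Finset.card_union_of_disjoint, Finset.card_image_of_injective]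
  · intro p q h
    simp only [Prod.mk.injEq, Nat.add_right_cancel_iff] at h
    exact Prod.ext h.1 h.2
  · rw [Finset.disjoint_left]
    intro x hx hx'
    obtain ⟨q, hq, rfl⟩ := Finset.mem_image.mp hx'
    have := E.lt_height hx
    simp only at this
    omega

theorem ofWord_append_singleton {I : Type*} [DecidableEq I] (G : SimpleGraph I) (w : List I)
    (a : I) : ofWord G (w ++ [a]) = superpose (ofWord G w) (single G a) := by
  simp [ofWord, prod]

theorem card_ofWord {I : Type*} [DecidableEq I] (G : SimpleGraph I) (w : List I) :
    (ofWord G w).pieces.card = w.length := by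
  induction w using List.reverseRecOn with
  | nil => rfl
  | append_singleton w a ih =>
    rw [ofWord_append_singleton, card_superpose, ih, List.length_append]
    rfl

/-- Removing a piece of maximal level from a heap, and dropping it again. -/
theorem exists_eq_superpose_single {I : Type*} [DecidableEq I] {G : SimpleGraph I} (E : Heap G)
    (hE : E.pieces.Nonempty) : ∃ (F : Heap G) (a : I), E = superpose F (single G a) := by
  classical
  obtain ⟨x, hx, hmax⟩ := Finset.exists_max_image E.pieces (fun p => p.2) hE
  let F : Heap G :=
    { pieces := E.pieces.erase x
      isPreHeap := fun p hp q hq => E.isPreHeap p (Finset.mem_of_mem_erase hp) q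
        (Finset.mem_of_mem_erase hq)
      supported := by
        intro p hp h
        obtain ⟨q, hq, he, hc⟩ := E.supported p (Finset.mem_of_mem_erase hp) h
        refine ⟨q, Finset.mem_erase.mpr ⟨?_, hq⟩, he, hc⟩
        rintro rfl
        have := hmax p (Finset.mem_of_mem_erase hp)
        omega }
  refine ⟨F, x.1, ?_⟩
  have hst : stack F (single G x.1) = insert (x.1, F.height) (E.pieces.erase x) := by
    rw [Finset.insert_eq, Finset.union_comm]
    simp [stack, single, F]
  have hlow : ∀ n, ∀ p ∈ E.pieces.erase x, p.2 = n →
      fallLevel G (stack F (single G x.1)) p = p.2 := by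
    intro n
    induction n using Nat.strong_induction_on with
    | _ n ih =>
      intro p hp hn
      apply le_antisymm
      · rw [fallLevel_eq]
        refine Finset.sup_le fun q hq => ?_
        obtain ⟨hq1, hq2, hq3⟩ := Finset.mem_filter.mp hq
        rw [hst, Finset.mem_insert] at hq1
        rcases hq1 with rfl | hq1
        · have := F.lt_height (p := p) hp
          simp only at hq2
          omega
        · rw [ih q.2 (hn ▸ hq2) q hq1 rfl]
          omega
      · rcases Nat.eq_zero_or_pos p.2 with h0 | h0
        · omega
        · obtain ⟨q, hq, he, hc⟩ := F.supported p hp h0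
          have h1 := fallLevel_lt G (stack F (single G x.1)) (p := p) (q := q)
            (by rw [hst]; exact Finset.mem_insert_of_mem hq) (by omega) hc
          rw [ih q.2 (by omega) q hq rfl] at h1
          omega
  have htop : fallLevel G (stack F (single G x.1)) (x.1, F.height) = x.2 := by
    apply le_antisymm
    · rw [fallLevel_eq]
      refine Finset.sup_le fun q hq => ?_
      obtain ⟨hq1, hq2, hq3⟩ := Finset.mem_filter.mp hq
      rw [hst, Finset.mem_insert] at hq1
      rcases hq1 with rfl | hq1
      · simp at hq2
      · rw [hlow _ q hq1 rfl]
        have hq4 := Finset.mem_erase.mp hq1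
        have h1 := hmax q hq4.2
        have h2 := E.isPreHeap q hq4.2 x hx hq4.1 hq3
        omega
    · rcases Nat.eq_zero_or_pos x.2 with h0 | h0
      · omega
      · obtain ⟨q, hq, he, hc⟩ := E.supported x hx h0
        have hq' : q ∈ F.pieces := Finset.mem_erase.mpr ⟨by rintro rfl; omega, hq⟩
        have h1 := fallLevel_lt G (stack F (single G x.1)) (p := (x.1, F.height)) (q := q)
          (by rw [hst]; exact Finset.mem_insert_of_mem hq') (F.lt_height hq') hc
        rw [hlow _ q hq' rfl] at h1
        omega
  apply Heap.ext
  change E.pieces = (stack F (single G x.1)).image _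
  rw [hst, Finset.image_insert, ← hst, htop]
  have himg : (E.pieces.erase x).image
      (fun p => (p.1, fallLevel G (stack F (single G x.1)) p)) = E.pieces.erase x := by
    conv_rhs => rw [← Finset.image_id (s := E.pieces.erase x)]
    refine Finset.image_congr fun p hp => ?_
    simp only [id]
    rw [hlow _ p hp rfl]
  rw [himg]
  exact (Finset.insert_erase hx).symm

theorem exists_ofWord {I : Type*} [DecidableEq I] {G : SimpleGraph I} (E : Heap G) :
    ∃ w, ofWord G w = E := by
  suffices h : ∀ n, ∀ E : Heap G, E.pieces.card = n → ∃ w, ofWord G w = E from h _ E rfl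
  intro n
  induction n with
  | zero =>
    intro E hE
    exact ⟨[], Heap.ext (Finset.card_eq_zero.mp hE).symm⟩
  | succ n ih =>
    intro E hE
    obtain ⟨F, a, rfl⟩ := exists_eq_superpose_single E (Finset.card_pos.mp (by omega))
    rw [card_superpose] at hE
    obtain ⟨w, rfl⟩ := ih F (by simpa [single] using hE)
    exact ⟨w ++ [a], ofWord_append_singleton G w a⟩

/-- Among the words of a heap there is a lexicographically greatest one. -/
theorem exists_isGreatest_word {I : Type*} [Finite I] [LinearOrder I] {G : SimpleGraph I}
    (E : Heap G) : ∃ w, IsGreatest {w : List I | ofWord G w = E} w := by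
  have hfin : {w : List I | ofWord G w = E}.Finite := by
    refine (List.finite_length_eq I E.pieces.card).subset fun w hw => ?_
    have hw' : ofWord G w = E := hw
    change w.length = _
    rw [← hw', card_ofWord]
  obtain ⟨w, hw, hmax⟩ := Set.exists_max_image _ id hfin (exists_ofWord E)
  exact ⟨w, hw, fun v hv => hmax v hv⟩

/-- The standard word of a heap: the lexicographically greatest of its words. -/
noncomputable def standardWord {I : Type*} [Finite I] [LinearOrder I] {G : SimpleGraph I}
    (E : Heap G) : List I :=
  E.exists_isGreatest_word.choose

theorem standardWord_isGreatest {I : Type*} [Finite I] [LinearOrder I] {G : SimpleGraph I}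
    (E : Heap G) : IsGreatest {w : List I | ofWord G w = E} E.standardWord :=
  E.exists_isGreatest_word.choose_spec

/-- Heaps are compared through their standard words, in the lexicographic order. -/
instance instLE {I : Type*} [Finite I] [LinearOrder I] {G : SimpleGraph I} : LE (Heap G) where
  le E F := E.standardWord ≤ F.standardWord

/-- `E` is primitive: `E = U ∘ V = V ∘ U` only if `U` or `V` is empty. -/
def IsPrimitive {I : Type*} [DecidableEq I] {G : SimpleGraph I} (E : Heap G) : Prop :=
  ∀ U V : Heap G, E = superpose U V → E = superpose V U → U = empty G ∨ V = empty G

/-- `F` is a transpose of `E`: `E = U ∘ V` and `F = V ∘ U` for some heaps `U` and `V`. -/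
def IsTranspose {I : Type*} [DecidableEq I] {G : SimpleGraph I} (E F : Heap G) : Prop :=
  ∃ U V : Heap G, E = superpose U V ∧ F = superpose V U

/-- The conjugacy relation of heaps: the transitive closure of transposition. -/
def IsConjugate {I : Type*} [DecidableEq I] {G : SimpleGraph I} (E F : Heap G) : Prop :=
  Relation.TransGen IsTranspose E F

/-- A Lyndon heap: non-empty, primitive, and minimal in its conjugacy class. -/
structure IsLyndon {I : Type*} [Finite I] [LinearOrder I] {G : SimpleGraph I}
    (E : Heap G) : Prop where
  ne_empty : E ≠ empty G
  isPrimitive : E.IsPrimitive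
  minimal : ∀ F : Heap G, IsConjugate E F → E ≤ F

/-- `L = [L₁, …, Lₖ]` is a Lyndon factorization of `E`: `E = L₁ ∘ ⋯ ∘ Lₖ`, all `Lᵢ` are Lyndon,
and `L₁ ≥ ⋯ ≥ Lₖ`. -/
structure IsLyndonFactorization {I : Type*} [Finite I] [LinearOrder I] {G : SimpleGraph I}
    (E : Heap G) (L : List (Heap G)) : Prop where
  prod_eq : prod L = E
  isLyndon : ∀ F ∈ L, F.IsLyndon
  antitone : L.Pairwise (fun F F' => F ≥ F')

/-- The Lyndon length: the number of factors in the Lyndon factorization. -/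
noncomputable def lyndonLength {I : Type*} [Finite I] [LinearOrder I] {G : SimpleGraph I}
    (E : Heap G) : ℕ :=
  sInf {k | ∃ L, E.IsLyndonFactorization L ∧ L.length = k}

/-- The weight of a heap: the number of its pieces in each position. -/
def weight {I : Type*} [DecidableEq I] {G : SimpleGraph I} (E : Heap G) (a : I) : ℕ :=
  (E.pieces.filter (fun p => p.1 = a)).card

/-- The heaps of weight `(1, …, 1)`: every vertex carries exactly one piece. -/
def IsMultilinear {I : Type*} [DecidableEq I] {G : SimpleGraph I} (E : Heap G) : Prop :=
  ∀ a : I, E.weight a = 1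

theorem finite_isMultilinear {I : Type*} [Finite I] [DecidableEq I] (G : SimpleGraph I) :
    {E : Heap G | E.IsMultilinear}.Finite := by
  have : Fintype I := Fintype.ofFinite I
  have hw : {w : List I | w.length = Fintype.card I}.Finite := List.finite_length_eq I _
  refine (hw.image (ofWord G)).subset fun E hE => ?_
  obtain ⟨w, rfl⟩ := exists_ofWord E
  refine ⟨w, ?_, rfl⟩
  change w.length = _
  have hE' : (ofWord G w).IsMultilinear := hE
  rw [← card_ofWord G w,
    Finset.card_eq_sum_card_fiberwise (f := Prod.fst) (t := Finset.univ) (by simp)]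
  exact (Finset.sum_congr rfl fun a _ => hE' a).trans (by simp)

/-- The finite set of all multilinear heaps over `G`. -/
noncomputable def multilinear {I : Type*} [Finite I] [DecidableEq I] (G : SimpleGraph I) :
    Finset (Heap G) :=
  (finite_isMultilinear G).toFinset

theorem mem_multilinear {I : Type*} [Finite I] [DecidableEq I] {G : SimpleGraph I}
    {E : Heap G} : E ∈ multilinear G ↔ E.IsMultilinear :=
  (finite_isMultilinear G).mem_toFinset

end Heap

/-! A multilinear heap amounts to an acyclic orientation of `G`: `Below` orients each edge from the
lower piece to the higher one, and by `IsSquarefree.ext` this orientation determines the heap. All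
arguments run over squarefree heaps with an arbitrary support `S`, so that induction on `S` is
available.

Conjugation changes an orientation by a potential. Hence a squarefree heap with only one source is
determined by its conjugacy class and that source, while a primitive one has a conjugate with any
prescribed position as its only source. Since a standard word starts with the greatest source, the
squarefree Lyndon heaps are exactly those whose only source is the least position
(`IsSquarefree.isLyndon_iff`). The last Lyndon factor therefore has to consist of everything above
the least position, and splitting it off repeatedly gives existence and uniqueness
(`IsSquarefree.isLyndonFactorization_iff`).

Put `P q S = ∑ q ^ ll(E)` over the squarefree heaps with support `S` (`lengthSum`). Splitting off
the last factor gives a recursion over the block of the least element, and this recursion makes `P`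
of binomial type in `q`: `P (q + r) S = ∑ P q T * P r (S \ T)`. Since `P 0` vanishes on nonempty
sets, `P (-1)` is the convolution inverse of `P 1`, which counts heaps. By Cartier–Foata inversion
that inverse is `(-1) ^ |T|` on independent sets `T` and zero elsewhere. Convolving `m` copies
splits `S` into `m` independent color classes, so `P (-m) S` is, up to the sign `(-1) ^ |S|`, the
number of proper `m`-colorings. Two polynomials that agree at all `-m` are equal. -/

namespace Heap

/-! ### Squarefree heaps as acyclic orientations -/

section Squarefree

variable {I : Type*} {G : SimpleGraph I}

/-- `a` and `b` are adjacent, and `E` has a piece at `a` below a piece at `b`. -/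
def Below (E : Heap G) (a b : I) : Prop :=
  G.Adj a b ∧ ∃ i j, (a, i) ∈ E.pieces ∧ (b, j) ∈ E.pieces ∧ i < j

/-- A heap is squarefree if it has at most one piece in each position. -/
def IsSquarefree (E : Heap G) : Prop := Set.InjOn Prod.fst (E.pieces : Set (I × ℕ))

theorem IsSquarefree.level_unique {E : Heap G} (hE : E.IsSquarefree) {a : I} {i j : ℕ}
    (hi : (a, i) ∈ E.pieces) (hj : (a, j) ∈ E.pieces) : i = j :=
  congrArg Prod.snd (hE hi hj rfl)

theorem isSquarefree_empty : (empty G).IsSquarefree := by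
  simp [IsSquarefree, empty]

theorem _root_.IsPreHeap.filter {P : Finset (I × ℕ)} (hP : IsPreHeap G P) (r : I × ℕ → Prop)
    [DecidablePred r] : IsPreHeap G (P.filter r) := fun p hp q hq =>
  hP p (Finset.mem_of_mem_filter p hp) q (Finset.mem_of_mem_filter q hq)

theorem IsSquarefree.below_asymm {E : Heap G} (hE : E.IsSquarefree) {a b : I}
    (h : E.Below a b) : ¬ E.Below b a := by
  rintro ⟨-, j, i, hj, hi, hlt⟩
  obtain ⟨-, i', j', hi', hj', hlt'⟩ := h
  rw [hE.level_unique hi' hi, hE.level_unique hj' hj] at hlt'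
  omega

/-- The level of a piece is the length of the longest `Below`-chain descending from it, so more
relations can only raise it. The induction follows the supporting piece one level down in `F`;
squarefreeness rules out that this piece has the same position, so it is an adjacent one. -/
theorem level_le_of_below_imp {E F : Heap G} (hF : F.IsSquarefree)
    (hE : E.IsSquarefree) (h : ∀ a b, F.Below a b → E.Below a b) :
    ∀ (j : ℕ) (a : I) (i : ℕ), (a, i) ∈ E.pieces → (a, j) ∈ F.pieces → j ≤ i := by
  intro j
  induction j using Nat.strong_induction_on with
  | _ j ih =>
    intro a i hi hj
    rcases Nat.eq_zero_or_pos j with h0 | h0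
    · omega
    obtain ⟨⟨b, k⟩, hk, hkj, hc⟩ := F.supported _ hj h0
    simp only at hkj hc
    have hadj : G.Adj b a := by
      rcases hc with rfl | hc
      · have := hF.level_unique hk hj
        omega
      · exact hc
    obtain ⟨-, k', i', hk', hi', hlt⟩ := h b a ⟨hadj, k, j, hk, hj, by omega⟩
    have := ih k (by omega) b k' hk' hk
    rw [hE.level_unique hi' hi] at hlt
    omega

variable [DecidableEq I]

/-- The set of positions of the pieces of a heap. -/
def support (E : Heap G) : Finset I := E.pieces.image Prod.fst

theorem mem_support {E : Heap G} {a : I} : a ∈ E.support ↔ ∃ i, (a, i) ∈ E.pieces := by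
  simp [support]

theorem Below.left_mem {E : Heap G} {a b : I} (h : E.Below a b) : a ∈ E.support :=
  mem_support.2 ⟨_, h.2.choose_spec.choose_spec.1⟩

theorem Below.right_mem {E : Heap G} {a b : I} (h : E.Below a b) : b ∈ E.support :=
  mem_support.2 ⟨_, h.2.choose_spec.choose_spec.2.1⟩

theorem isSquarefree_iff_card {E : Heap G} :
    E.IsSquarefree ↔ E.support.card = E.pieces.card :=
  Finset.card_image_iff.symm

theorem support_eq_empty {E : Heap G} : E.support = ∅ ↔ E = empty G := by
  rw [support, Finset.image_eq_empty, Heap.ext_iff]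
  rfl

@[simp]
theorem support_empty : (empty G).support = ∅ := support_eq_empty.2 rfl

@[simp]
theorem support_single (a : I) : (single G a).support = {a} := rfl

/-- Pieces in adjacent positions have different levels; this is what makes `Below` orient every edge
within the support. -/
theorem below_or_below (E : Heap G) {a b : I} (ha : a ∈ E.support) (hb : b ∈ E.support)
    (hab : G.Adj a b) : E.Below a b ∨ E.Below b a := by
  obtain ⟨i, hi⟩ := mem_support.1 ha
  obtain ⟨j, hj⟩ := mem_support.1 hb
  have hne := E.isPreHeap _ hi _ hj (fun h => hab.ne (congrArg Prod.fst h)) (Or.inr hab)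
  rcases lt_or_gt_of_ne hne with h | h
  · exact Or.inl ⟨hab, i, j, hi, hj, h⟩
  · exact Or.inr ⟨hab.symm, j, i, hj, hi, h⟩

/-- A nonempty set of positions of a squarefree heap contains a lowest one. -/
theorem IsSquarefree.exists_minimal {E : Heap G} (hE : E.IsSquarefree) {T : Finset I}
    (hT : T.Nonempty) (hTE : T ⊆ E.support) : ∃ a ∈ T, ∀ b ∈ T, ¬ E.Below b a := by
  obtain ⟨a, ha⟩ := hT
  obtain ⟨i, hi⟩ := mem_support.1 (hTE ha)
  obtain ⟨p, hp, hmin⟩ := Finset.exists_min_image (E.pieces.filter (fun p => p.1 ∈ T))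
    (fun p => p.2) ⟨(a, i), Finset.mem_filter.2 ⟨hi, ha⟩⟩
  obtain ⟨hp, hpT⟩ := Finset.mem_filter.1 hp
  refine ⟨p.1, hpT, fun b hb h => ?_⟩
  obtain ⟨-, i, j, hi, hj, hlt⟩ := h
  have h1 := hmin (b, i) (Finset.mem_filter.2 ⟨hi, hb⟩)
  rw [hE.level_unique hj hp] at hlt
  simp only at h1
  omega

/-- A squarefree heap is determined by its positions and by the way its pieces lie on each
other. -/
theorem IsSquarefree.ext {E F : Heap G} (hE : E.IsSquarefree) (hF : F.IsSquarefree)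
    (hsupp : E.support = F.support) (h : ∀ a b, E.Below a b → F.Below a b) : E = F := by
  have h' : ∀ a b, F.Below a b → E.Below a b := by
    intro a b hab
    refine (E.below_or_below (hsupp ▸ hab.left_mem) (hsupp ▸ hab.right_mem) hab.1).resolve_right
      fun hba => hF.below_asymm hab (h _ _ hba)
  have key : ∀ a i j, (a, i) ∈ E.pieces → (a, j) ∈ F.pieces → i = j := fun a i j hi hj =>
    le_antisymm (level_le_of_below_imp hE hF h i a j hj hi)
      (level_le_of_below_imp hF hE h' j a i hi hj)
  apply Heap.ext
  ext ⟨a, i⟩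
  constructor
  · intro hi
    obtain ⟨j, hj⟩ := mem_support.1 (hsupp ▸ mem_support.2 ⟨i, hi⟩)
    exact key a i j hi hj ▸ hj
  · intro hj
    obtain ⟨j, hi⟩ := mem_support.1 (hsupp ▸ mem_support.2 ⟨i, hj⟩)
    exact key a j i hi hj ▸ hi

theorem support_settle (P : Finset (I × ℕ)) (hP : IsPreHeap G P) :
    (settle G P hP).support = P.image Prod.fst := by
  simp only [support, settle, Finset.image_image]
  rfl

/-- Falling pieces never pass concurrent ones: `fallLevel` is strictly increasing along concurrent
pairs, and such pairs have distinct levels in `P`, which gives the converse. Levels can thus be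
forgotten in favor of the order. -/
theorem below_settle {P : Finset (I × ℕ)} {hP : IsPreHeap G P} {a b : I} :
    (settle G P hP).Below a b ↔
      G.Adj a b ∧ ∃ i j, (a, i) ∈ P ∧ (b, j) ∈ P ∧ i < j := by
  refine and_congr_right fun hab => ⟨?_, ?_⟩
  · rintro ⟨i, j, hi, hj, hlt⟩
    obtain ⟨⟨a', i'⟩, hp, hp'⟩ := Finset.mem_image.1 hi
    obtain ⟨⟨b', j'⟩, hq, hq'⟩ := Finset.mem_image.1 hj
    simp only [Prod.mk.injEq] at hp' hq'
    obtain ⟨rfl, rfl⟩ := hp'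
    obtain ⟨rfl, rfl⟩ := hq'
    refine ⟨i', j', hp, hq, ?_⟩
    have hne := hP _ hp _ hq (fun h => hab.ne (congrArg Prod.fst h)) (Or.inr hab)
    refine lt_of_le_of_ne (le_of_not_gt fun h => ?_) hne
    have := fallLevel_lt G P (p := (a', i')) hq h (Or.inr hab.symm)
    omega
  · rintro ⟨i, j, hi, hj, hlt⟩
    exact ⟨_, _, Finset.mem_image_of_mem _ hi, Finset.mem_image_of_mem _ hj,
      fallLevel_lt G P hi hlt (Or.inr hab)⟩

theorem isSquarefree_settle {P : Finset (I × ℕ)} {hP : IsPreHeap G P}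
    (h : Set.InjOn Prod.fst (P : Set (I × ℕ))) : (settle G P hP).IsSquarefree := by
  intro p hp q hq hpq
  obtain ⟨p', hp', rfl⟩ := Finset.mem_image.1 (Finset.mem_coe.1 hp)
  obtain ⟨q', hq', rfl⟩ := Finset.mem_image.1 (Finset.mem_coe.1 hq)
  rw [h hp' hq' hpq]

@[simp]
theorem support_superpose (E F : Heap G) :
    (superpose E F).support = E.support ∪ F.support := by
  rw [superpose, support_settle, stack, Finset.image_union, Finset.image_image]
  rfl

theorem below_superpose {E F : Heap G} {a b : I} :
    (superpose E F).Below a b ↔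
      E.Below a b ∨ F.Below a b ∨ (G.Adj a b ∧ a ∈ E.support ∧ b ∈ F.support) := by
  rw [superpose, below_settle]
  constructor
  · rintro ⟨hab, i, j, hi, hj, hlt⟩
    rcases Finset.mem_union.1 hi with hi | hi <;> rcases Finset.mem_union.1 hj with hj | hj
    · exact Or.inl ⟨hab, i, j, hi, hj, hlt⟩
    · obtain ⟨⟨b', j'⟩, hq, hq'⟩ := Finset.mem_image.1 hj
      simp only [Prod.mk.injEq] at hq'
      obtain ⟨rfl, rfl⟩ := hq'
      exact Or.inr (Or.inr ⟨hab, mem_support.2 ⟨_, hi⟩, mem_support.2 ⟨_, hq⟩⟩)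
    · obtain ⟨⟨a', i'⟩, hq, hq'⟩ := Finset.mem_image.1 hi
      simp only [Prod.mk.injEq] at hq'
      obtain ⟨rfl, rfl⟩ := hq'
      have := E.lt_height hj
      simp only at this
      omega
    · obtain ⟨⟨a', i'⟩, hp, hp'⟩ := Finset.mem_image.1 hi
      obtain ⟨⟨b', j'⟩, hq, hq'⟩ := Finset.mem_image.1 hj
      simp only [Prod.mk.injEq] at hp' hq'
      obtain ⟨rfl, rfl⟩ := hp'
      obtain ⟨rfl, rfl⟩ := hq'
      exact Or.inr (Or.inl ⟨hab, i', j', hp, hq, by omega⟩)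
  · have hF : ∀ c k, (c, k) ∈ F.pieces → (c, k + E.height) ∈ stack E F := fun c k h =>
      Finset.mem_union_right _ (Finset.mem_image.2 ⟨_, h, rfl⟩)
    rintro (⟨hab, i, j, hi, hj, hlt⟩ | ⟨hab, i, j, hi, hj, hlt⟩ | ⟨hab, ha, hb⟩)
    · exact ⟨hab, i, j, Finset.mem_union_left _ hi, Finset.mem_union_left _ hj, hlt⟩
    · exact ⟨hab, _, _, hF _ _ hi, hF _ _ hj, by omega⟩
    · obtain ⟨i, hi⟩ := mem_support.1 ha
      obtain ⟨j, hj⟩ := mem_support.1 hb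
      have := E.lt_height hi
      exact ⟨hab, _, _, Finset.mem_union_left _ hi, hF _ _ hj, by simp only at this; omega⟩

/-- A count: a heap is squarefree when it has as many positions as pieces. Pieces add up under
superposition, whereas positions do so only for disjoint supports. -/
theorem isSquarefree_superpose {E F : Heap G} :
    (superpose E F).IsSquarefree ↔
      E.IsSquarefree ∧ F.IsSquarefree ∧ Disjoint E.support F.support := by
  rw [isSquarefree_iff_card, isSquarefree_iff_card, isSquarefree_iff_card, support_superpose,
    card_superpose, ← Finset.card_union_eq_card_add_card]
  have h1 : E.support.card ≤ E.pieces.card := Finset.card_image_le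
  have h2 : F.support.card ≤ F.pieces.card := Finset.card_image_le
  have h3 := Finset.card_union_le E.support F.support
  omega

theorem not_below_empty {a b : I} : ¬ (empty G).Below a b := fun h => by
  simpa using h.left_mem

theorem not_below_single {a b c : I} : ¬ (single G c).Below a b := fun h => by
  have h1 := h.left_mem
  have h2 := h.right_mem
  rw [support_single, Finset.mem_singleton] at h1 h2
  exact h.1.ne (h1.trans h2.symm)

/-- The pieces of `E` in the positions in `T`, fallen down. -/
noncomputable def restrict (E : Heap G) (T : Finset I) : Heap G :=
  settle G (E.pieces.filter (fun p => p.1 ∈ T)) (E.isPreHeap.filter _)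

@[simp]
theorem support_restrict (E : Heap G) (T : Finset I) :
    (E.restrict T).support = E.support ∩ T := by
  rw [restrict, support_settle]
  ext a
  simp [mem_support]

theorem below_restrict {E : Heap G} {T : Finset I} {a b : I} :
    (E.restrict T).Below a b ↔ E.Below a b ∧ a ∈ T ∧ b ∈ T := by
  rw [restrict, below_settle]
  simp only [Below, Finset.mem_filter]
  tauto

theorem IsSquarefree.restrict {E : Heap G} (hE : E.IsSquarefree) (T : Finset I) :
    (E.restrict T).IsSquarefree :=
  isSquarefree_settle (hE.mono (Finset.coe_subset.2 (Finset.filter_subset _ _)))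

/-- A squarefree heap splits along a set `U` of positions that is closed upwards. -/
theorem IsSquarefree.superpose_restrict {E : Heap G} (hE : E.IsSquarefree) {D U : Finset I}
    (hDU : Disjoint D U) (hsupp : E.support = D ∪ U)
    (h : ∀ a ∈ U, ∀ b ∈ D, ¬ E.Below a b) :
    superpose (E.restrict D) (E.restrict U) = E := by
  symm
  refine hE.ext (isSquarefree_superpose.2 ⟨hE.restrict D, hE.restrict U, ?_⟩) ?_ ?_
  · simp only [support_restrict]
    exact hDU.mono Finset.inter_subset_right Finset.inter_subset_right
  · rw [support_superpose, support_restrict, support_restrict, hsupp]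
    ext a
    simp only [Finset.mem_union, Finset.mem_inter]
    tauto
  · intro a b hab
    rw [below_superpose, below_restrict, below_restrict, support_restrict, support_restrict]
    have ha := hab.left_mem
    have hb := hab.right_mem
    have ha' := ha
    have hb' := hb
    rw [hsupp, Finset.mem_union] at ha' hb'
    have := h a
    have h4 := hab.1
    simp only [Finset.mem_inter]
    by_cases h1 : a ∈ U
    · by_cases h2 : b ∈ U
      · tauto
      · exact absurd hab (h a h1 b (by tauto))
    · tauto

/-- Together with `restrict_superpose_right` this recovers both factors of a squarefree
superposition from their supports, which makes the decompositions below bijective. -/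
theorem restrict_superpose_left {E F : Heap G} (h : (superpose E F).IsSquarefree) :
    (superpose E F).restrict E.support = E := by
  obtain ⟨hE, hF, hd⟩ := isSquarefree_superpose.1 h
  refine (h.restrict _).ext hE ?_ ?_
  · rw [support_restrict, support_superpose, Finset.union_inter_cancel_left]
  · intro a b hab
    obtain ⟨hab, ha, hb⟩ := below_restrict.1 hab
    rcases below_superpose.1 hab with h1 | h1 | ⟨-, -, h1⟩
    · exact h1
    · exact absurd h1.left_mem (Finset.disjoint_left.1 hd ha)
    · exact absurd h1 (Finset.disjoint_left.1 hd hb)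

theorem restrict_superpose_right {E F : Heap G} (h : (superpose E F).IsSquarefree) :
    (superpose E F).restrict F.support = F := by
  obtain ⟨hE, hF, hd⟩ := isSquarefree_superpose.1 h
  refine (h.restrict _).ext hF ?_ ?_
  · rw [support_restrict, support_superpose, Finset.union_inter_cancel_right]
  · intro a b hab
    obtain ⟨hab, ha, hb⟩ := below_restrict.1 hab
    rcases below_superpose.1 hab with h1 | h1 | ⟨-, h1, -⟩
    · exact absurd ha (Finset.disjoint_left.1 hd h1.left_mem)
    · exact h1
    · exact absurd ha (Finset.disjoint_left.1 hd h1)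

/-- A source of `E`: a position whose piece lies on no other piece. -/
def IsSource (E : Heap G) (a : I) : Prop :=
  a ∈ E.support ∧ ∀ b, ¬ E.Below b a

theorem IsSquarefree.exists_isSource {E : Heap G} (hE : E.IsSquarefree)
    (hne : E.support.Nonempty) : ∃ a, E.IsSource a := by
  obtain ⟨a, ha, h⟩ := hE.exists_minimal hne subset_rfl
  exact ⟨a, ha, fun b hb => h b hb.left_mem hb⟩

theorem IsSource.superpose_left {E F : Heap G} {a : I} (ha : E.IsSource a)
    (h : (superpose E F).IsSquarefree) :
    (superpose E F).IsSource a := by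
  obtain ⟨hE, hF, hd⟩ := isSquarefree_superpose.1 h
  refine ⟨by simp [ha.1], fun b hb => ?_⟩
  have haF := Finset.disjoint_left.1 hd ha.1
  rcases below_superpose.1 hb with h1 | h1 | ⟨-, -, h1⟩
  · exact ha.2 b h1
  · exact haF h1.right_mem
  · exact haF h1

/-- In a squarefree heap with only one source, every piece is above the source. -/
theorem IsSquarefree.reflTransGen_of_unique_isSource {E : Heap G} (hE : E.IsSquarefree) {m : I}
    (hm : ∀ a, E.IsSource a → a = m) {a : I} (ha : a ∈ E.support) :
    Relation.ReflTransGen E.Below m a := by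
  classical
  by_contra hcon
  -- A lowest position `c` not reachable from `m` lies on no piece at all, so it is a source and
  -- must be `m` itself.
  obtain ⟨c, hc, hmin⟩ := hE.exists_minimal
    (T := E.support.filter (fun a => ¬ Relation.ReflTransGen E.Below m a))
    ⟨a, Finset.mem_filter.2 ⟨ha, hcon⟩⟩ (Finset.filter_subset _ _)
  obtain ⟨hc, hmc⟩ := Finset.mem_filter.1 hc
  have : E.IsSource c := by
    refine ⟨hc, fun b hb => ?_⟩
    by_cases hmb : Relation.ReflTransGen E.Below m b
    · exact hmc (hmb.tail hb)
    · exact hmin b (Finset.mem_filter.2 ⟨hb.left_mem, hmb⟩) hb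
  exact hmc (hm c this ▸ Relation.ReflTransGen.refl)

end Squarefree

end Heap

namespace Heap

/-! ### Words, conjugacy and sources -/

section Words

variable {I : Type*} [DecidableEq I] {G : SimpleGraph I}

@[simp]
theorem support_ofWord (w : List I) : (ofWord G w).support = w.toFinset := by
  induction w using List.reverseRecOn with
  | nil => exact support_empty
  | append_singleton w a ih =>
    rw [ofWord_append_singleton, support_superpose, ih, support_single, List.toFinset_append]
    rfl

theorem isSquarefree_ofWord {w : List I} : (ofWord G w).IsSquarefree ↔ w.Nodup := by
  rw [isSquarefree_iff_card, support_ofWord, card_ofWord]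
  exact Multiset.toFinset_card_eq_card_iff_nodup (m := (w : Multiset I))

theorem below_ofWord {w : List I} {a b : I} :
    (ofWord G w).Below a b ↔ G.Adj a b ∧ [a, b].Sublist w := by
  induction w using List.reverseRecOn with
  | nil =>
    simp only [List.sublist_nil, reduceCtorEq, and_false, iff_false]
    exact not_below_empty
  | append_singleton w c ih =>
    -- Reversal turns the appended letter into a head, so that a sublist can be examined letter by
    -- letter.
    have h : [a, b].Sublist (w ++ [c]) ↔ [a, b].Sublist w ∨ (a ∈ w ∧ b = c) := by
      rw [← List.reverse_sublist, ← List.reverse_sublist (l₂ := w)]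
      simp only [List.reverse_cons, List.reverse_nil, List.nil_append, List.cons_append,
        List.reverse_append]
      rw [List.cons_sublist_cons']
      simp [and_comm]
    rw [ofWord_append_singleton, below_superpose, ih, h, support_ofWord, support_single]
    simp only [not_below_single, List.mem_toFinset, Finset.mem_singleton]
    tauto

/-- A word of a squarefree heap may start with any of its sources. -/
theorem IsSource.ofWord_cons {E : Heap G} (hE : E.IsSquarefree) {a : I} (ha : E.IsSource a)
    {w : List I} (hw : ofWord G w = E.restrict (E.support.erase a)) :
    ofWord G (a :: w) = E := by
  have hsupp : w.toFinset = E.support.erase a := by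
    rw [← support_ofWord (G := G), hw, support_restrict,
      Finset.inter_eq_right.2 (Finset.erase_subset _ _)]
  have hnd : w.Nodup := isSquarefree_ofWord.1 (hw ▸ hE.restrict _)
  have haw : a ∉ w := by
    rw [← List.mem_toFinset, hsupp]
    exact Finset.notMem_erase _ _
  have hsupp' : (ofWord G (a :: w)).support = E.support := by
    rw [support_ofWord, List.toFinset_cons, hsupp, Finset.insert_erase ha.1]
  refine (isSquarefree_ofWord.2 (List.nodup_cons.2 ⟨haw, hnd⟩)).ext hE hsupp' ?_
  intro x y hxy
  obtain ⟨hadj, hs⟩ := below_ofWord.1 hxy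
  rw [List.cons_sublist_cons'] at hs
  rcases hs with hs | ⟨rfl, hs⟩
  · have := below_ofWord.2 ⟨hadj, hs⟩
    rw [hw] at this
    exact (below_restrict.1 this).1
  · refine (E.below_or_below ha.1 ?_ hadj).resolve_right (ha.2 y)
    exact hsupp' ▸ hxy.right_mem

open Classical in
/-- Conjugate squarefree heaps differ by a potential. -/
theorem IsConjugate.exists_potential {E F : Heap G} (h : IsConjugate E F)
    (hE : E.IsSquarefree) :
    F.IsSquarefree ∧ F.support = E.support ∧ ∃ f : I → ℤ, ∀ a ∈ E.support, ∀ b ∈ E.support,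
      G.Adj a b → (if F.Below a b then 1 else 0 : ℤ) =
        (if E.Below a b then 1 else 0) + f a - f b := by
  have step : ∀ E F : Heap G, IsTranspose E F → E.IsSquarefree →
      F.IsSquarefree ∧ F.support = E.support ∧ ∃ f : I → ℤ, ∀ a ∈ E.support, ∀ b ∈ E.support,
      G.Adj a b → (if F.Below a b then 1 else 0 : ℤ) =
        (if E.Below a b then 1 else 0) + f a - f b := by
    rintro _ _ ⟨U, V, rfl, rfl⟩ hE
    obtain ⟨hU, hV, hd⟩ := isSquarefree_superpose.1 hE
    -- Passing from `U ∘ V` to `V ∘ U` reverses exactly the edges between `U` and `V`, so the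
    -- potential is the indicator of `V`. Along a chain of transpositions the potentials add up.
    refine ⟨isSquarefree_superpose.2 ⟨hV, hU, hd.symm⟩, ?_, fun x => if x ∈ V.support then 1 else 0,
      fun a ha b hb hadj => ?_⟩
    · rw [support_superpose, support_superpose, Finset.union_comm]
    · have hda : a ∈ U.support → a ∉ V.support := fun h => Finset.disjoint_left.1 hd h
      have hdb : b ∈ U.support → b ∉ V.support := fun h => Finset.disjoint_left.1 hd h
      simp only [below_superpose, hadj, true_and]
      rw [support_superpose, Finset.mem_union] at ha hb
      have hU' : a ∈ V.support ∨ b ∈ V.support → ¬ U.Below a b := by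
        rintro (h | h) hab
        · exact hda hab.left_mem h
        · exact hdb hab.right_mem h
      have hV' : a ∈ U.support ∨ b ∈ U.support → ¬ V.Below a b := by
        rintro (h | h) hab
        · exact hda h hab.left_mem
        · exact hdb h hab.right_mem
      rcases ha with ha | ha <;> rcases hb with hb | hb
      · simp [ha, hb, hda ha, hdb hb, hV' (Or.inl ha)]
      · simp [ha, hb, hda ha, hU' (Or.inr hb), hV' (Or.inl ha)]
      · have h1 : a ∉ U.support := fun h => hda h ha
        simp [ha, hb, h1, hdb hb, hU' (Or.inl ha), hV' (Or.inr hb)]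
      · have h1 : a ∉ U.support := fun h => hda h ha
        have h2 : b ∉ U.support := fun h => hdb h hb
        simp [ha, hb, h1, h2, hU' (Or.inl ha)]
  induction h with
  | single h => exact step _ _ h hE
  | tail _ h ih =>
    obtain ⟨h1, h2, f, hf⟩ := ih
    obtain ⟨h3, h4, g, hg⟩ := step _ _ h h1
    refine ⟨h3, h4.trans h2, fun x => f x + g x, fun a ha b hb hadj => ?_⟩
    rw [hg a (h2 ▸ ha) b (h2 ▸ hb) hadj, hf a ha b hb hadj]
    ring

/-- Two conjugate squarefree heaps with the same unique source are equal. -/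
theorem IsConjugate.eq_of_unique_isSource {E F : Heap G} (h : IsConjugate E F)
    (hE : E.IsSquarefree) {m : I} (hmE : ∀ a, E.IsSource a → a = m)
    (hmF : ∀ a, F.IsSource a → a = m) : E = F := by
  classical
  obtain ⟨hF, hsupp, f, hf⟩ := h.exists_potential hE
  refine hE.ext hF hsupp.symm fun x y hxy => ?_
  -- Suppose `f` is not constant. An `E`-lowest position `s` where `f` is minimal is a source of
  -- `E`, and an `F`-lowest position `t` where it is not minimal is a source of `F`. Both must then
  -- equal `m`, although `f s < f t`.
  have hconst : ∀ x ∈ E.support, ∀ y ∈ E.support, f x ≤ f y := by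
    by_contra! hcon
    obtain ⟨x, hx, y, hy, hlt⟩ := hcon
    obtain ⟨c, hc, hmin⟩ := Finset.exists_min_image E.support f ⟨x, hx⟩
    obtain ⟨s, hs, hs'⟩ := hE.exists_minimal (T := E.support.filter (fun a => f a = f c))
      ⟨c, by simp [hc]⟩ (Finset.filter_subset _ _)
    obtain ⟨t, ht, ht'⟩ := hF.exists_minimal (T := E.support.filter (fun a => f c < f a))
      ⟨x, by simp only [Finset.mem_filter]; exact ⟨hx, (hmin y hy).trans_lt hlt⟩⟩
      (hsupp ▸ Finset.filter_subset _ _)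
    rw [Finset.mem_filter] at hs ht
    -- The two indicators differ by `f a - f b ≤ -1`, which forces the values 1 for `E` and 0 for
    -- `F`.
    have key : ∀ a ∈ E.support, ∀ b ∈ E.support, G.Adj a b → f a = f c → f c < f b →
        E.Below a b ∧ ¬ F.Below a b := by
      intro a ha b hb hadj h1 h2
      have := hf a ha b hb hadj
      by_cases h3 : E.Below a b <;> by_cases h4 : F.Below a b <;>
        simp only [h3, h4, if_true, if_false] at this ⊢ <;> first | omega | simp
    have hsE : E.IsSource s := by
      refine ⟨hs.1, fun b hb => ?_⟩
      rcases (hmin b hb.left_mem).eq_or_lt with h1 | h1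
      · exact hs' b (Finset.mem_filter.2 ⟨hb.left_mem, h1.symm⟩) hb
      · exact hE.below_asymm hb (key s hs.1 b hb.left_mem hb.1.symm hs.2 h1).1
    have htF : F.IsSource t := by
      refine ⟨hsupp ▸ ht.1, fun b hb => ?_⟩
      have hbE : b ∈ E.support := hsupp ▸ hb.left_mem
      rcases (hmin b hbE).eq_or_lt with h1 | h1
      · exact (key b hbE t ht.1 hb.1 h1.symm ht.2).2 hb
      · exact ht' b (Finset.mem_filter.2 ⟨hbE, h1⟩) hb
    have := (hmE s hsE).trans (hmF t htF).symm
    subst this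
    omega
  have h1 := hf x hxy.left_mem y hxy.right_mem hxy.1
  rw [le_antisymm (hconst x hxy.left_mem y hxy.right_mem)
    (hconst y hxy.right_mem x hxy.left_mem), if_pos hxy] at h1
  by_contra h2
  rw [if_neg h2] at h1
  omega

/-- A source of the lower factor is a source of the superposition. If `E = U ∘ V = V ∘ U` with both
nonempty, `U` and `V` would each have `m` as a source, but their supports are disjoint. -/
theorem IsSquarefree.isPrimitive_of_unique_isSource {E : Heap G} (hE : E.IsSquarefree) {m : I}
    (hm : ∀ a, E.IsSource a → a = m) : E.IsPrimitive := by
  intro U V h1 h2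
  by_contra! hcon
  rw [← support_eq_empty.ne, ← support_eq_empty.ne, ← Finset.nonempty_iff_ne_empty,
    ← Finset.nonempty_iff_ne_empty] at hcon
  have h1' : (superpose U V).IsSquarefree := h1 ▸ hE
  have h2' : (superpose V U).IsSquarefree := h2 ▸ hE
  obtain ⟨hU, hV, hd⟩ := isSquarefree_superpose.1 h1'
  obtain ⟨u, hu⟩ := hU.exists_isSource hcon.1
  obtain ⟨v, hv⟩ := hV.exists_isSource hcon.2
  have hu' := hm u (h1 ▸ hu.superpose_left h1')
  have hv' := hm v (h2 ▸ hv.superpose_left h2')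
  exact Finset.disjoint_left.1 hd hu.1 (hu' ▸ hv' ▸ hv.1)

/-- A transitive closure requires at least one step; transposition with the empty heap provides it.
-/
theorem IsSquarefree.isConjugate_refl {E : Heap G} (hE : E.IsSquarefree) : IsConjugate E E := by
  refine Relation.TransGen.single ⟨E, empty G, ?_, ?_⟩
  all_goals
    refine hE.ext (isSquarefree_superpose.2 ⟨?_, ?_, by simp⟩) (by simp) fun a b hab =>
      below_superpose.2 (by tauto)
    all_goals first | exact hE | exact isSquarefree_empty

/-- Every position of a primitive squarefree heap is the unique source of a conjugate. -/
theorem IsSquarefree.exists_isConjugate_unique_isSource {E : Heap G} (hE : E.IsSquarefree)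
    (hprim : E.IsPrimitive) {m : I} (hm : m ∈ E.support) :
    ∃ F, IsConjugate E F ∧ ∀ a, F.IsSource a → a = m := by
  classical
  suffices h : ∀ n, ∀ F, IsConjugate E F →
      (F.support.filter (fun a => ¬ Relation.ReflTransGen F.Below m a)).card = n →
      ∃ F, IsConjugate E F ∧ ∀ a, F.IsSource a → a = m from h _ E hE.isConjugate_refl rfl
  intro n
  induction n using Nat.strong_induction_on with
  | _ n ih =>
    intro F hEF hn
    obtain ⟨hF, hsupp, -⟩ := hEF.exists_potential hE
    -- The set `U` of positions reachable from `m` is closed upwards, so `F` is its part on `D`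
    -- below its part on `U`. Transposing the two keeps `U` reachable and makes a further position
    -- reachable, so `D` shrinks.
    set D := F.support.filter (fun a => ¬ Relation.ReflTransGen F.Below m a) with hD
    set U := F.support.filter (fun a => Relation.ReflTransGen F.Below m a) with hU
    have hDU : Disjoint D U := (Finset.disjoint_filter_filter_not _ _ _).symm
    have hunion : F.support = D ∪ U := by
      rw [Finset.union_comm, Finset.filter_union_filter_not_eq]
    rcases D.eq_empty_or_nonempty with hD0 | hDne
    · refine ⟨F, hEF, fun a ha => ?_⟩
      have haU : a ∈ U := by
        have := ha.1
        rwa [hunion, hD0, Finset.empty_union] at this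
      rcases (Finset.mem_filter.1 haU).2.cases_tail with h | ⟨b, -, h⟩
      · exact h
      · exact absurd h (ha.2 b)
    have hmU : m ∈ U := Finset.mem_filter.2 ⟨hsupp ▸ hm, Relation.ReflTransGen.refl⟩
    have hsplit := hF.superpose_restrict hDU hunion fun a ha b hb hab =>
      (Finset.mem_filter.1 hb).2 ((Finset.mem_filter.1 ha).2.tail hab)
    -- Without an edge between `U` and `D` the two parts commute in every heap on this support, in
    -- particular in `E`, whose primitivity forbids that.
    obtain ⟨u, hu, d, hd, hadj⟩ : ∃ u ∈ U, ∃ d ∈ D, G.Adj u d := by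
      by_contra! hcon
      have h1 := hE.superpose_restrict hDU (hsupp ▸ hunion)
        fun a ha b hb hab => hcon a ha b hb hab.1
      have h2 := hE.superpose_restrict hDU.symm (hsupp ▸ Finset.union_comm U D ▸ hunion)
        fun a ha b hb hab => hcon b hb a ha hab.1.symm
      rcases hprim _ _ h1.symm h2.symm with h | h
      · rw [← support_eq_empty, support_restrict, ← hsupp, Finset.inter_eq_right.2
          (Finset.filter_subset _ _)] at h
        exact hDne.ne_empty h
      · rw [← support_eq_empty, support_restrict, ← hsupp, Finset.inter_eq_right.2
          (Finset.filter_subset _ _)] at h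
        exact Finset.notMem_empty m (h ▸ hmU)
    set F' := superpose (F.restrict U) (F.restrict D) with hF'
    have hFF' : IsTranspose F F' := ⟨_, _, hsplit.symm, rfl⟩
    have hsupp' : F'.support = F.support := by
      rw [hF', support_superpose, Finset.union_comm, ← support_superpose, hsplit]
    have hreach : ∀ x, Relation.ReflTransGen F.Below m x → Relation.ReflTransGen F'.Below m x := by
      intro x hx
      induction hx with
      | refl => exact Relation.ReflTransGen.refl
      | tail h hbc ih =>
        exact ih.tail (below_superpose.2 (Or.inl (below_restrict.2 ⟨hbc,
          Finset.mem_filter.2 ⟨hbc.left_mem, h⟩, Finset.mem_filter.2 ⟨hbc.right_mem, h.tail hbc⟩⟩)))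
    have hud : F'.Below u d := below_superpose.2 (Or.inr (Or.inr ⟨hadj, by
      rw [support_restrict]
      exact Finset.mem_inter.2 ⟨Finset.filter_subset _ _ hu, hu⟩, by
      rw [support_restrict]
      exact Finset.mem_inter.2 ⟨Finset.filter_subset _ _ hd, hd⟩⟩))
    refine ih _ ?_ F' (hEF.tail hFF') rfl
    rw [← hn]
    refine Finset.card_lt_card (Finset.ssubset_iff_of_subset ?_ |>.2 ⟨d, hd, ?_⟩)
    · intro x hx
      rw [Finset.mem_filter, hsupp'] at hx
      exact Finset.mem_filter.2 ⟨hx.1, fun h => hx.2 (hreach x h)⟩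
    · rw [Finset.mem_filter, not_and_not_right]
      exact fun _ => (hreach u (Finset.mem_filter.1 hu).2).tail hud

end Words

/-! ### Standard words and squarefree Lyndon heaps -/

section Order

theorem cons_lt_cons_of_lt {I : Type*} [LinearOrder I] {a b : I} {v w : List I} (h : a < b) : a :: v < b :: w :=
  List.Lex.rel h

theorem le_of_cons_le_cons {I : Type*} [LinearOrder I] {a b : I} {v w : List I} (h : a :: v ≤ b :: w) : a ≤ b :=
  not_lt.1 fun hlt => h.not_gt (cons_lt_cons_of_lt hlt)

variable {I : Type*} [Finite I] [LinearOrder I] {G : SimpleGraph I}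

theorem ofWord_standardWord (E : Heap G) : ofWord G E.standardWord = E :=
  E.standardWord_isGreatest.1

theorem le_standardWord {E : Heap G} {w : List I} (h : ofWord G w = E) : w ≤ E.standardWord :=
  E.standardWord_isGreatest.2 h

/-- The standard word of a nonempty squarefree heap starts with its greatest source. -/
theorem IsSquarefree.exists_standardWord_eq_cons {E : Heap G} (hE : E.IsSquarefree)
    (hne : E.support.Nonempty) :
    ∃ a w, E.standardWord = a :: w ∧ E.IsSource a ∧ ∀ b, E.IsSource b → b ≤ a := by
  have hw := E.ofWord_standardWord
  cases h : E.standardWord with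
  | nil =>
    rw [h] at hw
    rw [← hw] at hne
    simp at hne
  | cons a w =>
    rw [h] at hw
    have hnd : (a :: w).Nodup := isSquarefree_ofWord.1 (hw.symm ▸ hE)
    refine ⟨a, w, rfl, ⟨?_, fun b hb => ?_⟩, fun b hb => ?_⟩
    · rw [← hw, support_ofWord]
      simp
    · rw [← hw] at hb
      obtain ⟨hadj, hs⟩ := below_ofWord.1 hb
      rw [List.cons_sublist_cons'] at hs
      rcases hs with hs | ⟨rfl, -⟩
      · exact (List.nodup_cons.1 hnd).1 (hs.subset (by simp))
      · exact hadj.ne rfl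
    -- Some word of `E` starts with the source `b`; it is at most the standard word, hence so is its
    -- first letter.
    · obtain ⟨v, hv⟩ := exists_ofWord (E.restrict (E.support.erase b))
      have hle := le_standardWord (hb.ofWord_cons hE hv)
      rw [h] at hle
      exact le_of_cons_le_cons hle

/-- `m` is the least position of `E` and its only source. -/
def IsRooted (E : Heap G) (m : I) : Prop :=
  IsLeast (E.support : Set I) m ∧ ∀ a, E.IsSource a → a = m

theorem IsSquarefree.standardWord_of_isRooted {E : Heap G} (hE : E.IsSquarefree) {m : I}
    (hm : E.IsRooted m) : ∃ w, E.standardWord = m :: w := by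
  obtain ⟨a, w, h, ha, -⟩ := hE.exists_standardWord_eq_cons ⟨m, hm.1.1⟩
  exact ⟨w, hm.2 a ha ▸ h⟩

/-- The first letter, the greatest source, decides the comparison. A primitive heap has a conjugate
whose only source is the least position `m`, so minimality pushes every source of `E` down to `m`.
Conversely, the greatest source of a conjugate `F` of a rooted `E` is at least `m`; if it is `m`,
then `m` is the only source of `F` and `F = E`. -/
theorem IsSquarefree.isLyndon_iff {E : Heap G} (hE : E.IsSquarefree) :
    E.IsLyndon ↔ ∃ m, E.IsRooted m := by
  constructor
  · intro h
    have hne : E.support.Nonempty := by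
      rw [Finset.nonempty_iff_ne_empty]
      exact fun h0 => h.ne_empty (support_eq_empty.1 h0)
    have hm := E.support.isLeast_min' hne
    set m := E.support.min' hne
    obtain ⟨F, hEF, hF⟩ := hE.exists_isConjugate_unique_isSource h.isPrimitive hm.1
    obtain ⟨hFs, hsupp, -⟩ := hEF.exists_potential hE
    have hFm : F.IsRooted m := ⟨hsupp ▸ hm, hF⟩
    obtain ⟨w, hw⟩ := hFs.standardWord_of_isRooted hFm
    obtain ⟨a, v, hv, ha, hmax⟩ := hE.exists_standardWord_eq_cons hne
    have hle : E.standardWord ≤ F.standardWord := h.minimal F hEF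
    rw [hw, hv] at hle
    exact ⟨m, hm, fun b hb => le_antisymm ((hmax b hb).trans (le_of_cons_le_cons hle)) (hm.2 hb.1)⟩
  · rintro ⟨m, hm⟩
    refine ⟨?_, hE.isPrimitive_of_unique_isSource hm.2, fun F hEF => ?_⟩
    · rintro rfl
      simpa using hm.1.1
    · obtain ⟨hFs, hsupp, -⟩ := hEF.exists_potential hE
      obtain ⟨w, hw⟩ := hE.standardWord_of_isRooted hm
      obtain ⟨a, v, hv, ha, hmax⟩ := hFs.exists_standardWord_eq_cons ⟨m, hsupp ▸ hm.1.1⟩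
      have hma : m ≤ a := hm.1.2 (hsupp ▸ ha.1)
      rcases hma.eq_or_lt with h | h
      · subst h
        have : E = F := hEF.eq_of_unique_isSource hE hm.2 fun b hb =>
          le_antisymm (hmax b hb) (hm.1.2 (hsupp ▸ hb.1))
        exact this ▸ le_refl E.standardWord
      · change E.standardWord ≤ F.standardWord
        rw [hw, hv]
        exact (cons_lt_cons_of_lt h).le

end Order

end Heap

namespace Heap

/-! ### The Lyndon factorization of a squarefree heap -/

section Factorization

variable {I : Type*} [LinearOrder I] {G : SimpleGraph I}

theorem prod_append_singleton (L : List (Heap G)) (F : Heap G) :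
    prod (L ++ [F]) = superpose (prod L) F := by
  simp [prod]

theorem mem_support_prod {L : List (Heap G)} {a : I} :
    a ∈ (prod L).support ↔ ∃ F ∈ L, a ∈ F.support := by
  induction L using List.reverseRecOn with
  | nil => simp [prod]
  | append_singleton L F ih =>
    rw [prod_append_singleton, support_superpose, Finset.mem_union, ih]
    simp [or_and_right, exists_or]

theorem IsSquarefree.of_mem_prod {L : List (Heap G)} (h : (prod L).IsSquarefree) {F : Heap G}
    (hF : F ∈ L) : F.IsSquarefree := by
  induction L using List.reverseRecOn with
  | nil => simp at hF
  | append_singleton L F' ih =>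
    rw [prod_append_singleton, isSquarefree_superpose] at h
    rcases List.mem_append.1 hF with hF | hF
    · exact ih h.1 hF
    · exact List.mem_singleton.1 hF ▸ h.2.1

open Classical in
/-- The positions of `E` that carry a piece above the least position. -/
noncomputable def lastSupport (E : Heap G) : Finset I :=
  E.support.filter (fun a => ∃ m, IsLeast (E.support : Set I) m ∧ Relation.ReflTransGen E.Below m a)

theorem lastSupport_subset (E : Heap G) : E.lastSupport ⊆ E.support := by
  classical
  exact Finset.filter_subset _ _

theorem mem_lastSupport {E : Heap G} {m a : I} (hm : IsLeast (E.support : Set I) m) :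
    a ∈ E.lastSupport ↔ a ∈ E.support ∧ Relation.ReflTransGen E.Below m a := by
  classical
  rw [lastSupport, Finset.mem_filter]
  refine and_congr_right fun _ => ⟨?_, fun h => ⟨m, hm, h⟩⟩
  rintro ⟨m', hm', h⟩
  exact hm.unique hm' ▸ h

theorem mem_lastSupport_of_isLeast {E : Heap G} {m : I} (hm : IsLeast (E.support : Set I) m) :
    m ∈ E.lastSupport := (mem_lastSupport hm).2 ⟨hm.1, Relation.ReflTransGen.refl⟩

/-- The last Lyndon factor of a squarefree heap. -/
noncomputable def lastFactor (E : Heap G) : Heap G := E.restrict E.lastSupport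

/-- What is left of a heap when its last Lyndon factor is removed. -/
noncomputable def initPart (E : Heap G) : Heap G := E.restrict (E.support \ E.lastSupport)

@[simp]
theorem support_lastFactor (E : Heap G) : E.lastFactor.support = E.lastSupport := by
  rw [lastFactor, support_restrict, Finset.inter_eq_right.2 E.lastSupport_subset]

@[simp]
theorem support_initPart (E : Heap G) : E.initPart.support = E.support \ E.lastSupport := by
  rw [initPart, support_restrict, Finset.inter_eq_right.2 Finset.sdiff_subset]

theorem IsSquarefree.superpose_initPart_lastFactor {E : Heap G} (hE : E.IsSquarefree) :
    superpose E.initPart E.lastFactor = E := by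
  classical
  refine hE.superpose_restrict Finset.sdiff_disjoint
    (Finset.sdiff_union_of_subset E.lastSupport_subset).symm fun a ha b hb hab => ?_
  rw [Finset.mem_sdiff] at hb
  obtain ⟨m, hm, h⟩ := (Finset.mem_filter.1 ha).2
  exact hb.2 ((mem_lastSupport hm).2 ⟨hb.1, h.tail hab⟩)

/-- Any other position reachable from `m` has a predecessor on a path from `m`, which is reachable
too, so it is no source of the restriction. -/
theorem isRooted_lastFactor {E : Heap G} {m : I}
    (hm : IsLeast (E.support : Set I) m) : E.lastFactor.IsRooted m := by
  refine ⟨⟨?_, fun a ha => ?_⟩, fun a ha => ?_⟩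
  · rw [support_lastFactor]
    exact mem_lastSupport_of_isLeast hm
  · rw [support_lastFactor] at ha
    exact hm.2 (E.lastSupport_subset ha)
  · have haU := ha.1
    rw [support_lastFactor, mem_lastSupport hm] at haU
    rcases haU.2.cases_tail with h | ⟨b, h, hba⟩
    · exact h
    · refine absurd (below_restrict.2 ⟨hba, ?_, ?_⟩) (ha.2 b)
      · exact (mem_lastSupport hm).2 ⟨hba.left_mem, h⟩
      · exact (mem_lastSupport hm).2 haU

/-- A rooted heap below which a heap with greater positions is put is the last factor. -/
theorem IsRooted.lastSupport_superpose {A B : Heap G} (h : (superpose B A).IsSquarefree) {m : I}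
    (hA : A.IsRooted m) (hm : IsLeast ((superpose B A).support : Set I) m) :
    (superpose B A).lastSupport = A.support := by
  obtain ⟨hB, hAs, hd⟩ := isSquarefree_superpose.1 h
  ext a
  rw [mem_lastSupport hm]
  constructor
  · rintro ⟨-, ha⟩
    induction ha with
    | refl => exact hA.1.1
    -- An upward path that starts in `A` stays there, since no piece of `B` lies on a piece of `A`.
    | tail _ hbc ih =>
      rcases below_superpose.1 hbc with h1 | h1 | ⟨-, -, h1⟩
      · exact absurd ih (Finset.disjoint_left.1 hd h1.left_mem)
      · exact h1.right_mem
      · exact h1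
  · intro ha
    refine ⟨by simp [ha], ?_⟩
    exact Relation.ReflTransGen.mono (fun x y hxy => below_superpose.2 (Or.inr (Or.inl hxy))) _ _
      (hAs.reflTransGen_of_unique_isSource hA.2 ha)

theorem IsRooted.lastFactor_superpose {A B : Heap G} (h : (superpose B A).IsSquarefree) {m : I}
    (hA : A.IsRooted m) (hm : IsLeast ((superpose B A).support : Set I) m) :
    (superpose B A).lastFactor = A := by
  rw [lastFactor, hA.lastSupport_superpose h hm, restrict_superpose_right h]

theorem IsRooted.initPart_superpose {A B : Heap G} (h : (superpose B A).IsSquarefree) {m : I}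
    (hA : A.IsRooted m) (hm : IsLeast ((superpose B A).support : Set I) m) :
    (superpose B A).initPart = B := by
  rw [initPart, hA.lastSupport_superpose h hm, support_superpose,
    Finset.union_sdiff_cancel_right (isSquarefree_superpose.1 h).2.2, restrict_superpose_left h]

theorem card_support_initPart_lt {E : Heap G} (hne : E.support.Nonempty) :
    E.initPart.support.card < E.support.card := by
  have hm := E.support.isLeast_min' hne
  rw [support_initPart]
  exact Finset.card_lt_card (Finset.sdiff_ssubset E.lastSupport_subset
    ⟨_, mem_lastSupport_of_isLeast hm⟩)

variable [Finite I]

theorem isLyndonFactorization_empty {L : List (Heap G)} :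
    (empty G).IsLyndonFactorization L ↔ L = [] := by
  constructor
  · intro h
    by_contra hL
    obtain ⟨F, hF⟩ := List.exists_mem_of_ne_nil L hL
    refine (h.isLyndon F hF).ne_empty (support_eq_empty.1 ?_)
    refine Finset.eq_empty_of_forall_notMem fun a ha => ?_
    have := mem_support_prod.2 ⟨F, hF, ha⟩
    rw [h.prod_eq] at this
    simp at this
  · rintro rfl
    exact ⟨rfl, by simp, List.Pairwise.nil⟩

/-- The Lyndon factorizations of a nonempty squarefree heap end with its last factor. -/
theorem IsSquarefree.isLyndonFactorization_iff {E : Heap G} (hE : E.IsSquarefree)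
    (hne : E.support.Nonempty) {L : List (Heap G)} :
    E.IsLyndonFactorization L ↔
      ∃ L', L = L' ++ [E.lastFactor] ∧ E.initPart.IsLyndonFactorization L' := by
  have hm := E.support.isLeast_min' hne
  set m := E.support.min' hne
  constructor
  · intro h
    rcases List.eq_nil_or_concat L with rfl | ⟨L', F, rfl⟩
    · rw [← h.prod_eq] at hne
      simp [prod] at hne
    · have hprod := h.prod_eq
      rw [List.concat_eq_append, prod_append_singleton] at hprod
      subst hprod
      obtain ⟨hL', hF, hd⟩ := isSquarefree_superpose.1 hE
      obtain ⟨k, hk⟩ := hF.isLyndon_iff.1 (h.isLyndon F (by simp))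
      have hpair := h.antitone
      rw [List.concat_eq_append, List.pairwise_append] at hpair
      -- If `m` lies in an earlier factor `F'` with root `k'`, then `F' ≥ F` gives `k ≤ k'` by first
      -- letters, and `k' ≤ m`. So the last factor contains the least position in any case.
      have hkm : k = m := by
        refine le_antisymm ?_ (hm.2 ?_)
        · have hm1 := hm.1
          rw [Finset.mem_coe, support_superpose, Finset.mem_union] at hm1
          rcases hm1 with hm1 | hm1
          · obtain ⟨F', hF', hmF'⟩ := mem_support_prod.1 hm1
            have hF's := hL'.of_mem_prod hF'
            obtain ⟨k', hk'⟩ := hF's.isLyndon_iff.1 (h.isLyndon F' (by simp [hF']))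
            have hle : F.standardWord ≤ F'.standardWord := hpair.2.2 F' hF' F (by simp)
            obtain ⟨v, hv⟩ := hF.standardWord_of_isRooted hk
            obtain ⟨w, hw⟩ := hF's.standardWord_of_isRooted hk'
            rw [hv, hw] at hle
            exact (le_of_cons_le_cons hle).trans (hk'.1.2 hmF')
          · exact hk.1.2 hm1
        · rw [Finset.mem_coe, support_superpose]
          exact Finset.mem_union_right _ hk.1.1
      subst hkm
      rw [hk.lastFactor_superpose hE hm, hk.initPart_superpose hE hm]
      exact ⟨L', List.concat_eq_append, rfl, fun F' hF' => h.isLyndon F' (by simp [hF']), hpair.1⟩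
  · rintro ⟨L', rfl, h⟩
    have hroot := isRooted_lastFactor hm
    have hlast : E.lastFactor.IsSquarefree := hE.restrict _
    have hinit : E.initPart.IsSquarefree := hE.restrict _
    refine ⟨?_, ?_, ?_⟩
    · rw [prod_append_singleton, h.prod_eq, hE.superpose_initPart_lastFactor]
    · intro F hF
      rcases List.mem_append.1 hF with hF | hF
      · exact h.isLyndon F hF
      · rw [List.mem_singleton.1 hF]
        exact hlast.isLyndon_iff.2 ⟨m, hroot⟩
    · refine List.pairwise_append.2 ⟨h.antitone, by simp, fun F hF F' hF' => ?_⟩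
      rw [List.mem_singleton.1 hF']
      have hFs : F.IsSquarefree := (h.prod_eq.symm ▸ hinit : (prod L').IsSquarefree).of_mem_prod hF
      obtain ⟨k, hk⟩ := hFs.isLyndon_iff.1 (h.isLyndon F hF)
      obtain ⟨v, hv⟩ := hFs.standardWord_of_isRooted hk
      obtain ⟨w, hw⟩ := hlast.standardWord_of_isRooted hroot
      have hkE := mem_support_prod.2 ⟨F, hF, hk.1.1⟩
      rw [h.prod_eq, support_initPart, Finset.mem_sdiff] at hkE
      change E.lastFactor.standardWord ≤ F.standardWord
      rw [hv, hw]
      -- The roots of the other factors exceed `m`, which has been removed with the last factor; the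
      -- first letters settle the comparison.
      refine (cons_lt_cons_of_lt (lt_of_le_of_ne (hm.2 hkE.1) ?_)).le
      rintro rfl
      exact hkE.2 (mem_lastSupport_of_isLeast hm)

/-- Every squarefree heap has exactly one Lyndon factorization. -/
theorem IsSquarefree.existsUnique_isLyndonFactorization {E : Heap G} (hE : E.IsSquarefree) :
    ∃! L : List (Heap G), E.IsLyndonFactorization L := by
  induction hn : E.support.card using Nat.strong_induction_on generalizing E with
  | _ n ih =>
    rcases E.support.eq_empty_or_nonempty with h0 | hne
    · rw [support_eq_empty.1 h0]
      exact ⟨[], isLyndonFactorization_empty.2 rfl, fun L hL => isLyndonFactorization_empty.1 hL⟩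
    · obtain ⟨L, hL, huniq⟩ := ih _ (hn ▸ card_support_initPart_lt hne) (E := E.initPart)
        (hE.restrict _) rfl
      refine ⟨L ++ [E.lastFactor], (hE.isLyndonFactorization_iff hne).2 ⟨L, rfl, hL⟩, ?_⟩
      intro L' hL'
      obtain ⟨L'', rfl, h⟩ := (hE.isLyndonFactorization_iff hne).1 hL'
      rw [huniq L'' h]

/-- By uniqueness the infimum is taken over a singleton, so its default value on the empty set plays
no role. -/
theorem IsSquarefree.lyndonLength_eq {E : Heap G} (hE : E.IsSquarefree) {L : List (Heap G)}
    (hL : E.IsLyndonFactorization L) : E.lyndonLength = L.length := by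
  have : {k | ∃ L, E.IsLyndonFactorization L ∧ L.length = k} = {L.length} := by
    ext k
    constructor
    · rintro ⟨L', hL', rfl⟩
      rw [hE.existsUnique_isLyndonFactorization.unique hL' hL]
      rfl
    · rintro rfl
      exact ⟨L, hL, rfl⟩
  rw [lyndonLength, this, csInf_singleton]

@[simp]
theorem lyndonLength_empty : (empty G).lyndonLength = 0 :=
  isSquarefree_empty.lyndonLength_eq (isLyndonFactorization_empty.2 rfl)

theorem IsSquarefree.lyndonLength_initPart {E : Heap G} (hE : E.IsSquarefree)
    (hne : E.support.Nonempty) : E.lyndonLength = E.initPart.lyndonLength + 1 := by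
  have hinit : E.initPart.IsSquarefree := hE.restrict _
  obtain ⟨L, hL, -⟩ := hinit.existsUnique_isLyndonFactorization
  rw [hinit.lyndonLength_eq hL,
    hE.lyndonLength_eq ((hE.isLyndonFactorization_iff hne).2 ⟨L, rfl, hL⟩)]
  simp

end Factorization

end Heap

/-! ### Set functions of binomial type -/

section BinomialType

variable {I : Type*} [LinearOrder I]

/-- A family of functions on finite sets that is defined by picking out the block of the least
element is of binomial type. -/
theorem binomialType_of_recursion (lam : Finset I → ℤ) (P : ℤ → Finset I → ℤ)
    (h0 : ∀ q, P q ∅ = 1)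
    (hP : ∀ (q : ℤ) (S : Finset I) (m : I), IsLeast (S : Set I) m →
      P q S = q * ∑ T ∈ S.powerset.filter (m ∈ ·), lam T * P q (S \ T))
    (q r : ℤ) (S : Finset I) :
    P (q + r) S = ∑ T ∈ S.powerset, P q T * P r (S \ T) := by
  induction S using Finset.strongInduction with
  | H S ih =>
    rcases S.eq_empty_or_nonempty with rfl | hne
    · simp [h0]
    have hm := S.isLeast_min' hne
    set m := S.min' hne
    have hmS : m ∈ S := hm.1
    -- The sum over `B` is split according to the side on which `m` falls. Here `m ∈ B`: the factor
    -- `P q B` is expanded along the block `T` of `m`, and the pairs `T ⊆ B` are reindexed by `T`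
    -- and `A = B \ T`.
    have hleft : ∑ B ∈ S.powerset.filter (m ∈ ·), P q B * P r (S \ B) =
        q * ∑ T ∈ S.powerset.filter (m ∈ ·), lam T *
          ∑ A ∈ (S \ T).powerset, P q A * P r ((S \ T) \ A) := by
      have h1 : ∀ B ∈ S.powerset.filter (m ∈ ·), P q B * P r (S \ B) =
          ∑ T ∈ B.powerset.filter (m ∈ ·), q * (lam T * (P q (B \ T) * P r (S \ B))) := by
        intro B hB
        rw [Finset.mem_filter, Finset.mem_powerset] at hB
        rw [hP q B m ⟨hB.2, fun x hx => hm.2 (hB.1 hx)⟩, Finset.mul_sum, Finset.sum_mul]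
        exact Finset.sum_congr rfl fun T _ => by ring
      rw [Finset.sum_congr rfl h1, Finset.mul_sum]
      simp only [Finset.mul_sum]
      rw [Finset.sum_sigma', Finset.sum_sigma']
      refine Finset.sum_bij' (fun x _ => ⟨x.2, x.1 \ x.2⟩) (fun x _ => ⟨x.1 ∪ x.2, x.1⟩)
        ?_ ?_ ?_ ?_ ?_
      · rintro ⟨B, T⟩ hx
        simp only [Finset.mem_sigma, Finset.mem_filter, Finset.mem_powerset] at hx ⊢
        exact ⟨⟨hx.2.1.trans hx.1.1, hx.2.2⟩, Finset.sdiff_subset_sdiff hx.1.1 subset_rfl⟩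
      · rintro ⟨T, A⟩ hx
        simp only [Finset.mem_sigma, Finset.mem_filter, Finset.mem_powerset] at hx ⊢
        exact ⟨⟨Finset.union_subset hx.1.1 (hx.2.trans Finset.sdiff_subset),
          Finset.mem_union_left _ hx.1.2⟩, Finset.subset_union_left, hx.1.2⟩
      · rintro ⟨B, T⟩ hx
        simp only [Finset.mem_sigma, Finset.mem_filter, Finset.mem_powerset] at hx
        simp [Finset.union_sdiff_of_subset hx.2.1]
      · rintro ⟨T, A⟩ hx
        simp only [Finset.mem_sigma, Finset.mem_filter, Finset.mem_powerset] at hx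
        have hd : Disjoint T A := Finset.disjoint_of_subset_right hx.2 Finset.disjoint_sdiff
        simp [Finset.union_sdiff_cancel_left hd]
      · rintro ⟨B, T⟩ hx
        simp only [Finset.mem_sigma, Finset.mem_filter, Finset.mem_powerset] at hx
        simp only [sdiff_sdiff_left, Finset.sup_eq_union, Finset.union_sdiff_of_subset hx.2.1]
    -- Here `m ∉ B`: the factor `P r (S \ B)` is expanded instead, and `T` and `B` are disjoint
    -- subsets of `S`.
    have hright : ∑ B ∈ S.powerset.filter (¬ m ∈ ·), P q B * P r (S \ B) =
        r * ∑ T ∈ S.powerset.filter (m ∈ ·), lam T *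
          ∑ A ∈ (S \ T).powerset, P q A * P r ((S \ T) \ A) := by
      have h1 : ∀ B ∈ S.powerset.filter (¬ m ∈ ·), P q B * P r (S \ B) =
          ∑ T ∈ (S \ B).powerset.filter (m ∈ ·),
            r * (lam T * (P q B * P r ((S \ T) \ B))) := by
        intro B hB
        rw [Finset.mem_filter, Finset.mem_powerset] at hB
        rw [hP r (S \ B) m ⟨by simp [hmS, hB.2], fun x hx =>
            hm.2 (Finset.mem_sdiff.1 hx).1⟩,
          Finset.mul_sum, Finset.mul_sum]
        refine Finset.sum_congr rfl fun T _ => ?_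
        rw [sdiff_right_comm]
        ring
      rw [Finset.sum_congr rfl h1, Finset.mul_sum]
      simp only [Finset.mul_sum]
      refine Finset.sum_comm' fun B T => ?_
      simp only [Finset.mem_filter, Finset.mem_powerset, Finset.subset_sdiff]
      constructor
      · rintro ⟨⟨h1, h2⟩, ⟨h3, h4⟩, h5⟩
        exact ⟨⟨h1, h4.symm⟩, h3, h5⟩
      · rintro ⟨⟨h1, h4⟩, h3, h5⟩
        exact ⟨⟨h1, fun h => Finset.disjoint_left.1 h4 h h5⟩, ⟨h3, h4.symm⟩, h5⟩
    -- Both halves carry the same sum, with coefficients `q` and `r`; its inner sums are `P (q + r)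
    -- (S \ T)` by induction.
    rw [← Finset.sum_filter_add_sum_filter_not _ (m ∈ ·), hleft, hright, ← add_mul,
      hP (q + r) S m hm]
    congr 1
    refine Finset.sum_congr rfl fun T hT => ?_
    rw [Finset.mem_filter, Finset.mem_powerset] at hT
    rw [ih _ (Finset.sdiff_ssubset hT.1 ⟨m, hT.2⟩)]

end BinomialType

namespace Heap

/-! ### Heaps of independent sets -/

section Flat

variable {I : Type*} [DecidableEq I] {G : SimpleGraph I}

/-- The heap with one piece of level zero in each position of an independent set. -/
def flat {T : Finset I} (hT : G.IsIndepSet T) : Heap G where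
  pieces := T.image (fun a => (a, 0))
  isPreHeap := by
    intro p hp q hq hne hc
    obtain ⟨a, ha, rfl⟩ := Finset.mem_image.1 hp
    obtain ⟨b, hb, rfl⟩ := Finset.mem_image.1 hq
    rcases hc with rfl | hc
    · exact absurd rfl hne
    · exact absurd hc (hT ha hb hc.ne)
  supported := by
    intro p hp h
    obtain ⟨a, ha, rfl⟩ := Finset.mem_image.1 hp
    exact absurd h (lt_irrefl 0)

theorem support_flat {T : Finset I} (hT : G.IsIndepSet T) : (flat hT).support = T := by
  ext a
  simp [mem_support, flat]

theorem isSquarefree_flat {T : Finset I} (hT : G.IsIndepSet T) : (flat hT).IsSquarefree := by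
  rintro ⟨a, i⟩ hp ⟨b, j⟩ hq h
  simp only [flat, Finset.coe_image, Set.mem_image, Prod.mk.injEq] at hp hq
  obtain ⟨-, -, -, hi⟩ := hp
  obtain ⟨-, -, -, hj⟩ := hq
  exact Prod.ext h (hi.symm.trans hj)

theorem not_below_flat {T : Finset I} (hT : G.IsIndepSet T) {a b : I} :
    ¬ (flat hT).Below a b := fun h =>
  hT (support_flat hT ▸ h.left_mem) (support_flat hT ▸ h.right_mem) h.1.ne h.1

end Flat

/-! ### The generating function of the Lyndon length -/

section Counting

variable {I : Type*} [Finite I] [LinearOrder I] (G : SimpleGraph I)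

theorem finite_setOf_isSquarefree_support_eq (S : Finset I) :
    {E : Heap G | E.IsSquarefree ∧ E.support = S}.Finite := by
  refine ((List.finite_length_eq I S.card).image (ofWord G)).subset ?_
  rintro E ⟨hE, rfl⟩
  obtain ⟨w, rfl⟩ := exists_ofWord E
  exact ⟨w, by rw [Set.mem_ofPred_eq, isSquarefree_iff_card.1 hE, card_ofWord], rfl⟩

/-- The squarefree heaps whose set of positions is `S`. -/
noncomputable def supportedOn (S : Finset I) : Finset (Heap G) :=
  (finite_setOf_isSquarefree_support_eq G S).toFinset

variable {G} in
theorem mem_supportedOn {S : Finset I} {E : Heap G} :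
    E ∈ supportedOn G S ↔ E.IsSquarefree ∧ E.support = S :=
  (finite_setOf_isSquarefree_support_eq G S).mem_toFinset

theorem supportedOn_empty : supportedOn G ∅ = {empty G} := by
  ext E
  rw [mem_supportedOn, support_eq_empty, Finset.mem_singleton]
  exact and_iff_right_of_imp fun h => h ▸ isSquarefree_empty

open Classical in
/-- The squarefree heaps with the set of positions `S` and with `min S` as their only source. -/
noncomputable def rootedOn (S : Finset I) : Finset (Heap G) :=
  (supportedOn G S).filter (fun E => ∃ m, E.IsRooted m)

/-- The generating function of the Lyndon length over the squarefree heaps with the set of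
positions `S`. -/
noncomputable def lengthSum (q : ℤ) (S : Finset I) : ℤ :=
  ∑ E ∈ supportedOn G S, q ^ E.lyndonLength

theorem lengthSum_empty (q : ℤ) : lengthSum G q ∅ = 1 := by
  simp [lengthSum, supportedOn_empty]

theorem lengthSum_one (S : Finset I) : lengthSum G 1 S = (supportedOn G S).card := by
  simp [lengthSum]

/-- The heaps whose last factor has support `T` correspond to pairs of a rooted heap on `T` and an
arbitrary squarefree heap on `S \ T`. The removed factor accounts for one power of `q`. -/
theorem lengthSum_eq_mul_sum (q : ℤ) (S : Finset I) (m : I) (hm : IsLeast (S : Set I) m) :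
    lengthSum G q S = q * ∑ T ∈ S.powerset.filter (m ∈ ·),
      ((rootedOn G T).card : ℤ) * lengthSum G q (S \ T) := by
  classical
  have hmaps : ∀ E ∈ supportedOn G S, E.lastSupport ∈ S.powerset.filter (m ∈ ·) := by
    intro E hE
    obtain ⟨hE, rfl⟩ := mem_supportedOn.1 hE
    exact Finset.mem_filter.2 ⟨Finset.mem_powerset.2 E.lastSupport_subset,
      mem_lastSupport_of_isLeast hm⟩
  rw [lengthSum, ← Finset.sum_fiberwise_of_maps_to hmaps, Finset.mul_sum]
  refine Finset.sum_congr rfl fun T hT => ?_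
  rw [Finset.mem_filter, Finset.mem_powerset] at hT
  have hright : q * (((rootedOn G T).card : ℤ) * lengthSum G q (S \ T)) =
      ∑ x ∈ rootedOn G T ×ˢ supportedOn G (S \ T), q ^ (x.2.lyndonLength + 1) := by
    rw [Finset.sum_product, lengthSum]
    simp only [pow_succ, ← Finset.sum_mul, Finset.sum_const, nsmul_eq_mul]
    ring
  rw [hright]
  have hinv : ∀ x ∈ rootedOn G T ×ˢ supportedOn G (S \ T),
      (superpose x.2 x.1).IsSquarefree ∧ (superpose x.2 x.1).support = S ∧
        x.1.support = T ∧ x.1.IsRooted m := by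
    rintro ⟨A, B⟩ hx
    rw [Finset.mem_product, rootedOn, Finset.mem_filter, mem_supportedOn, mem_supportedOn] at hx
    obtain ⟨⟨⟨hA, hAT⟩, k, hk⟩, hB, hBS⟩ := hx
    simp only at hA hAT hk hB hBS
    refine ⟨isSquarefree_superpose.2 ⟨hB, hA, ?_⟩, ?_, hAT, ?_⟩
    · rw [hAT, hBS]
      exact Finset.sdiff_disjoint
    · rw [support_superpose, hAT, hBS, Finset.sdiff_union_of_subset hT.1]
    · have : IsLeast (A.support : Set I) m := by
        rw [hAT]
        exact ⟨hT.2, fun x hx => hm.2 (hT.1 hx)⟩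
      exact hk.1.unique this ▸ hk
  refine Finset.sum_bij' (fun E _ => (E.lastFactor, E.initPart)) (fun x _ => superpose x.2 x.1)
    ?_ ?_ ?_ ?_ ?_
  · intro E hE
    rw [Finset.mem_filter, mem_supportedOn] at hE
    obtain ⟨⟨hE, rfl⟩, rfl⟩ := hE
    rw [Finset.mem_product, rootedOn, Finset.mem_filter, mem_supportedOn, mem_supportedOn]
    exact ⟨⟨⟨hE.restrict _, support_lastFactor E⟩, m, isRooted_lastFactor hm⟩, hE.restrict _,
      support_initPart E⟩
  · intro x hx
    obtain ⟨h1, h2, h3, h4⟩ := hinv x hx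
    rw [Finset.mem_filter, mem_supportedOn]
    exact ⟨⟨h1, h2⟩, (h4.lastSupport_superpose h1 (h2.symm ▸ hm)).trans h3⟩
  · intro E hE
    rw [Finset.mem_filter, mem_supportedOn] at hE
    exact hE.1.1.superpose_initPart_lastFactor
  · intro x hx
    obtain ⟨h1, h2, h3, h4⟩ := hinv x hx
    exact Prod.ext (h4.lastFactor_superpose h1 (h2.symm ▸ hm))
      (h4.initPart_superpose h1 (h2.symm ▸ hm))
  · intro E hE
    rw [Finset.mem_filter, mem_supportedOn] at hE
    obtain ⟨⟨hE, rfl⟩, rfl⟩ := hE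
    rw [hE.lyndonLength_initPart ⟨m, hm.1⟩]

theorem lengthSum_zero {S : Finset I} (hS : S.Nonempty) : lengthSum G 0 S = 0 := by
  rw [lengthSum_eq_mul_sum G 0 S _ (S.isLeast_min' hS), zero_mul]

theorem lengthSum_add (q r : ℤ) (S : Finset I) :
    lengthSum G (q + r) S = ∑ T ∈ S.powerset, lengthSum G q T * lengthSum G r (S \ T) :=
  binomialType_of_recursion (fun T => ((rootedOn G T).card : ℤ)) (lengthSum G)
    (lengthSum_empty G) (lengthSum_eq_mul_sum G) q r S

variable {G}

-- Sources are pairwise non-adjacent, so only independent `T` contribute. For these, taking away the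
-- bottom layer `T` is inverse to putting a heap on `S \ T` over `flat hT`.
open Classical in
theorem card_filter_forall_isSource {S T : Finset I} (hTS : T ⊆ S) :
    ((supportedOn G S).filter (fun E => ∀ a ∈ T, E.IsSource a)).card =
      if G.IsIndepSet T then (supportedOn G (S \ T)).card else 0 := by
  split_ifs with hT
  · refine Finset.card_bij' (fun E _ => E.restrict (S \ T)) (fun E _ => superpose (flat hT) E)
      ?_ ?_ ?_ ?_
    · intro E hE
      rw [Finset.mem_filter, mem_supportedOn] at hE
      rw [mem_supportedOn, support_restrict, hE.1.2, Finset.inter_eq_right.2 Finset.sdiff_subset]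
      exact ⟨hE.1.1.restrict _, rfl⟩
    · intro E hE
      rw [mem_supportedOn] at hE
      have hsq : (superpose (flat hT) E).IsSquarefree := by
        refine isSquarefree_superpose.2 ⟨isSquarefree_flat hT, hE.1, ?_⟩
        rw [support_flat, hE.2]
        exact Finset.disjoint_sdiff
      rw [Finset.mem_filter, mem_supportedOn, support_superpose, support_flat, hE.2,
        Finset.union_sdiff_of_subset hTS]
      refine ⟨⟨hsq, rfl⟩, fun a ha => IsSource.superpose_left ⟨?_, fun b => not_below_flat hT⟩ hsq⟩
      rwa [support_flat]
    · intro E hE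
      rw [Finset.mem_filter, mem_supportedOn] at hE
      obtain ⟨⟨hE, rfl⟩, hsrc⟩ := hE
      have h1 : flat hT = E.restrict T := by
        refine (isSquarefree_flat hT).ext (hE.restrict T) ?_ fun a b h =>
          absurd h (not_below_flat hT)
        rw [support_flat, support_restrict, Finset.inter_eq_right.2 hTS]
      simp only [h1]
      exact hE.superpose_restrict Finset.disjoint_sdiff (Finset.union_sdiff_of_subset hTS).symm
        fun a _ b hb => (hsrc b hb).2 a
    · intro E hE
      rw [mem_supportedOn] at hE
      have hsq : (superpose (flat hT) E).IsSquarefree := by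
        refine isSquarefree_superpose.2 ⟨isSquarefree_flat hT, hE.1, ?_⟩
        rw [support_flat, hE.2]
        exact Finset.disjoint_sdiff
      simp only [← hE.2]
      exact restrict_superpose_right hsq
  · rw [Finset.card_eq_zero, Finset.filter_eq_empty_iff]
    intro E _ hsrc
    refine hT fun a ha b hb _ hab => ?_
    rcases E.below_or_below (hsrc a ha).1 (hsrc b hb).1 hab with h | h
    · exact (hsrc b hb).2 a h
    · exact (hsrc a ha).2 b h

open Classical in
/-- The inversion formula of Cartier and Foata for squarefree heaps. -/
theorem sum_indep_mul_card_supportedOn {S : Finset I} (hS : S.Nonempty) :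
    ∑ T ∈ S.powerset, (if G.IsIndepSet T then (-1) ^ T.card else 0 : ℤ) *
      lengthSum G 1 (S \ T) = 0 := by
  have h1 : ∀ T ∈ S.powerset, (if G.IsIndepSet T then (-1) ^ T.card else 0 : ℤ) *
      lengthSum G 1 (S \ T) =
      ∑ E ∈ supportedOn G S, if ∀ a ∈ T, E.IsSource a then (-1) ^ T.card else 0 := by
    intro T hT
    rw [← Finset.sum_filter, Finset.sum_const, card_filter_forall_isSource
      (Finset.mem_powerset.1 hT), lengthSum_one]
    split_ifs
    · rw [nsmul_eq_mul, mul_comm]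
    · simp
  rw [Finset.sum_congr rfl h1, Finset.sum_comm]
  -- For a fixed `E`, the signs are summed over all subsets of its set of sources, which is
  -- nonempty, so they cancel.
  refine Finset.sum_eq_zero fun E hES => ?_
  obtain ⟨hE, rfl⟩ := mem_supportedOn.1 hES
  rw [← Finset.sum_filter]
  have h2 : E.support.powerset.filter (fun T => ∀ a ∈ T, E.IsSource a) =
      (E.support.filter E.IsSource).powerset := by
    ext T
    simp only [Finset.mem_filter, Finset.mem_powerset, Finset.subset_iff]
    exact ⟨fun h a ha => ⟨h.1 ha, h.2 a ha⟩, fun h => ⟨fun a ha => (h ha).1, fun a ha => (h ha).2⟩⟩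
  rw [h2]
  obtain ⟨a, ha⟩ := hE.exists_isSource hS
  exact Finset.sum_powerset_neg_one_pow_card_of_nonempty ⟨a, Finset.mem_filter.2 ⟨ha.1, ha⟩⟩

-- Both sides are convolution inverses of `lengthSum G 1`: the left one by additivity at `-1 + 1 =
-- 0`, the right one by Cartier–Foata inversion. As `lengthSum G 1 ∅ = 1`, the term `T = S` is
-- determined by the smaller ones.
open Classical in
theorem lengthSum_neg_one (S : Finset I) :
    lengthSum G (-1) S = if G.IsIndepSet S then (-1) ^ S.card else 0 := by
  induction S using Finset.strongInduction with
  | H S ih =>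
    rcases S.eq_empty_or_nonempty with rfl | hne
    · simp [lengthSum_empty]
    have h1 := lengthSum_add G (-1) 1 S
    rw [neg_add_cancel, lengthSum_zero G hne] at h1
    have h2 := sum_indep_mul_card_supportedOn (G := G) hne
    rw [← Finset.add_sum_erase _ _ (Finset.mem_powerset_self S)] at h1 h2
    have h3 : ∑ T ∈ S.powerset.erase S, lengthSum G (-1) T * lengthSum G 1 (S \ T) =
        ∑ T ∈ S.powerset.erase S, (if G.IsIndepSet T then (-1) ^ T.card else 0 : ℤ) *
          lengthSum G 1 (S \ T) := by
      refine Finset.sum_congr rfl fun T hT => ?_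
      rw [Finset.mem_erase, Finset.mem_powerset] at hT
      rw [ih T (Finset.ssubset_iff_subset_ne.2 ⟨hT.2, hT.1⟩)]
    rw [h3, sdiff_self, Finset.bot_eq_empty, lengthSum_empty, mul_one] at h1
    rw [sdiff_self, Finset.bot_eq_empty, lengthSum_empty, mul_one] at h2
    linarith

end Counting

end Heap

/-! ### Counting proper colorings by color classes -/

section Colorings

variable {I : Type*} [Fintype I] [DecidableEq I] (G : SimpleGraph I)

open Classical in
/-- The proper colorings of the vertices in `S` with colors less than `m`, extended by zero. -/
noncomputable def partialColorings (S : Finset I) (m : ℕ) : Finset (I → ℕ) :=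
  (Fintype.piFinset fun a => if a ∈ S then Finset.range m else {0}).filter
    (fun c => ∀ a ∈ S, ∀ b ∈ S, G.Adj a b → c a ≠ c b)

variable {G}

theorem mem_partialColorings {S : Finset I} {m : ℕ} {c : I → ℕ} :
    c ∈ partialColorings G S m ↔ (∀ a ∈ S, c a < m) ∧ (∀ a ∉ S, c a = 0) ∧
      ∀ a ∈ S, ∀ b ∈ S, G.Adj a b → c a ≠ c b := by
  classical
  rw [partialColorings, Finset.mem_filter, Fintype.mem_piFinset, ← and_assoc]
  refine and_congr_left fun _ => ⟨fun h => ⟨fun a ha => ?_, fun a ha => ?_⟩, fun h a => ?_⟩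
  · simpa [ha] using h a
  · simpa [ha] using h a
  · by_cases ha : a ∈ S
    · simpa [ha] using h.1 a ha
    · simpa [ha] using h.2 a ha

theorem partialColorings_empty (m : ℕ) : (partialColorings G ∅ m).card = 1 := by
  rw [Finset.card_eq_one]
  refine ⟨0, ?_⟩
  ext c
  rw [mem_partialColorings, Finset.mem_singleton, funext_iff]
  simp

theorem partialColorings_zero {S : Finset I} (hS : S.Nonempty) :
    (partialColorings G S 0).card = 0 := by
  rw [Finset.card_eq_zero, Finset.eq_empty_iff_forall_notMem]
  intro c hc
  obtain ⟨a, ha⟩ := hS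
  exact absurd ((mem_partialColorings.1 hc).1 a ha) (Nat.not_lt_zero _)

open Classical in
/-- A coloring with `m + 1` colors consists of an independent set, colored with the last color,
and of a coloring of the other vertices with `m` colors. -/
theorem card_partialColorings_succ (S : Finset I) (m : ℕ) :
    (partialColorings G S (m + 1)).card =
      ∑ T ∈ S.powerset, if G.IsIndepSet T then (partialColorings G (S \ T) m).card else 0 := by
  have hmaps : ∀ c ∈ partialColorings G S (m + 1), S.filter (fun a => c a = m) ∈ S.powerset :=
    fun c _ => Finset.mem_powerset.2 (Finset.filter_subset _ _)
  rw [Finset.card_eq_sum_card_fiberwise hmaps]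
  refine Finset.sum_congr rfl fun T hT => ?_
  rw [Finset.mem_powerset] at hT
  split_ifs with hind
  -- With `T` the class of the last color `m`, the two maps erase that color to the default value 0
  -- and restore it.
  · refine Finset.card_bij' (fun c _ a => if a ∈ T then 0 else c a)
      (fun c _ a => if a ∈ T then m else c a) ?_ ?_ ?_ ?_
    · intro c hc
      rw [Finset.mem_filter, mem_partialColorings] at hc
      obtain ⟨⟨h1, h2, h3⟩, rfl⟩ := hc
      rw [mem_partialColorings]
      simp only [Finset.mem_sdiff, Finset.mem_filter, not_and]
      refine ⟨fun a ha => ?_, fun a ha => ?_, fun a ha b hb hab => ?_⟩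
      · have h4 := h1 a ha.1
        have h5 := ha.2 ha.1
        simp only [ha.1, h5, and_false, if_false]
        omega
      · split_ifs with h
        · rfl
        · by_cases haS : a ∈ S
          · exact absurd (ha haS) (by tauto)
          · exact h2 a haS
      · simp only [ha.2 ha.1, hb.2 hb.1, and_false, if_false]
        exact h3 a ha.1 b hb.1 hab
    · intro c hc
      obtain ⟨h1, h2, h3⟩ := mem_partialColorings.1 hc
      simp only [Finset.mem_sdiff] at h1 h2 h3
      rw [Finset.mem_filter, mem_partialColorings]
      refine ⟨⟨fun a ha => ?_, fun a ha => ?_, fun a ha b hb hab => ?_⟩, ?_⟩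
      · split_ifs with h
        · omega
        · have := h1 a ⟨ha, h⟩
          omega
      · rw [if_neg fun h => ha (hT h)]
        exact h2 a fun h => ha h.1
      · by_cases haT : a ∈ T <;> by_cases hbT : b ∈ T
        · exact absurd hab (hind haT hbT hab.ne)
        · have := h1 b ⟨hb, hbT⟩
          simp only [haT, hbT, if_true, if_false]
          omega
        · have := h1 a ⟨ha, haT⟩
          simp only [haT, hbT, if_true, if_false]
          omega
        · simp only [haT, hbT, if_false]
          exact h3 a ⟨ha, haT⟩ b ⟨hb, hbT⟩ hab
      · ext a
        rw [Finset.mem_filter]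
        constructor
        · rintro ⟨ha, h⟩
          by_contra haT
          simp only [if_neg haT] at h
          have := h1 a ⟨ha, haT⟩
          omega
        · exact fun h => ⟨hT h, if_pos h⟩
    · intro c hc
      rw [Finset.mem_filter] at hc
      obtain ⟨-, rfl⟩ := hc
      funext a
      simp only
      split_ifs with h
      · exact (Finset.mem_filter.1 h).2.symm
      · rfl
    · intro c hc
      obtain ⟨-, h2, -⟩ := mem_partialColorings.1 hc
      funext a
      simp only
      split_ifs with h
      · exact (h2 a (by simp [h])).symm
      · rfl
  · rw [Finset.card_eq_zero, Finset.filter_eq_empty_iff]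
    rintro c hc rfl
    obtain ⟨-, -, h3⟩ := mem_partialColorings.1 hc
    refine hind fun a ha b hb _ hab => ?_
    rw [Finset.mem_coe, Finset.mem_filter] at ha hb
    exact h3 a ha.1 b hb.1 hab (ha.2.trans hb.2.symm)

theorem card_coloring_eq (m : ℕ) :
    Nat.card (G.Coloring (Fin m)) = (partialColorings G Finset.univ m).card := by
  rw [← Fintype.card_coe, ← Nat.card_eq_fintype_card]
  refine Nat.card_congr
    { toFun := fun c => ⟨fun a => (c a : ℕ), mem_partialColorings.2 ⟨fun a _ => (c a).2,
        fun a ha => absurd (Finset.mem_univ a) ha,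
        fun a _ b _ hab h => c.valid hab (Fin.ext h)⟩⟩
      invFun := fun c => SimpleGraph.Coloring.mk
        (fun a => ⟨c.1 a, (mem_partialColorings.1 c.2).1 a (Finset.mem_univ a)⟩)
        fun {a b} hab h => (mem_partialColorings.1 c.2).2.2 a (Finset.mem_univ a) b
          (Finset.mem_univ b) hab (congrArg Fin.val h)
      left_inv := fun c => rfl
      right_inv := fun c => rfl }

end Colorings

/-! ### Comparison with the chromatic polynomial -/

namespace Heap

variable {I : Type*} [LinearOrder I] {G : SimpleGraph I}

/-- Writing `-(m + 1) = -1 + -m`, additivity in `q` becomes the recursion that removes the class `T`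
of the last color; the signs of `T` and `S \ T` multiply to that of `S`. -/
theorem lengthSum_neg_natCast [Fintype I] (m : ℕ) (S : Finset I) :
    lengthSum G (-m) S = (-1) ^ S.card * (partialColorings G S m).card := by
  classical
  induction m generalizing S with
  | zero =>
    rcases S.eq_empty_or_nonempty with rfl | hne
    · simp [lengthSum_empty, partialColorings_empty]
    · simp [lengthSum_zero G hne, partialColorings_zero hne]
  | succ m ih =>
    have h : (-((m + 1 : ℕ) : ℤ)) = -1 + -(m : ℤ) := by
      push_cast
      ring
    rw [h, lengthSum_add, card_partialColorings_succ, Nat.cast_sum, Finset.mul_sum]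
    refine Finset.sum_congr rfl fun T hT => ?_
    rw [ih, lengthSum_neg_one]
    split_ifs
    · rw [← mul_assoc, ← pow_add, Finset.card_sdiff_of_subset (Finset.mem_powerset.1 hT),
        Nat.add_sub_cancel' (Finset.card_le_card (Finset.mem_powerset.1 hT))]
    · simp

theorem multilinear_eq_supportedOn [Fintype I] : multilinear G = supportedOn G Finset.univ := by
  ext E
  rw [mem_multilinear, mem_supportedOn, IsMultilinear]
  simp only [weight, Finset.card_eq_one]
  constructor
  · intro h
    constructor
    · intro p hp q hq hpq
      obtain ⟨x, hx⟩ := h p.1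
      have h1 : p ∈ E.pieces.filter (fun r => r.1 = p.1) := Finset.mem_filter.2 ⟨hp, rfl⟩
      have h2 : q ∈ E.pieces.filter (fun r => r.1 = p.1) := Finset.mem_filter.2 ⟨hq, hpq.symm⟩
      rw [hx, Finset.mem_singleton] at h1 h2
      exact h1.trans h2.symm
    · refine Finset.eq_univ_of_forall fun a => ?_
      obtain ⟨x, hx⟩ := h a
      have h1 := Finset.mem_filter.1 (hx ▸ Finset.mem_singleton_self x :
        x ∈ E.pieces.filter (fun r => r.1 = a))
      exact h1.2 ▸ Finset.mem_image_of_mem Prod.fst h1.1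
  · rintro ⟨h1, h2⟩ a
    obtain ⟨i, hi⟩ := mem_support.1 (h2 ▸ Finset.mem_univ a : a ∈ E.support)
    refine ⟨(a, i), ?_⟩
    ext p
    rw [Finset.mem_filter, Finset.mem_singleton]
    constructor
    · rintro ⟨hp, hpa⟩
      exact h1 hp hi hpa
    · rintro rfl
      exact ⟨hi, rfl⟩

/-- It suffices to compare values at the infinitely many points `-m`, where the left side is `(-1) ^
n` times the number of proper `m`-colorings. -/
theorem signedChromaticPolynomial_eq_sum [Finite I] :
    signedChromaticPolynomial G =
      ∑ E ∈ Heap.multilinear G, (Polynomial.X : Polynomial ℤ) ^ E.lyndonLength := by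
  have : Fintype I := Fintype.ofFinite I
  refine Polynomial.eq_of_infinite_eval_eq _ _ ?_
  refine (Set.infinite_range_of_injective
    (neg_injective.comp (Nat.cast_injective (R := ℤ)))).mono ?_
  rintro _ ⟨m, rfl⟩
  have h := lengthSum_neg_natCast (G := G) m Finset.univ
  rw [Set.mem_ofPred_eq, multilinear_eq_supportedOn, Polynomial.eval_finsetSum]
  simp only [Function.comp, Polynomial.eval_pow, Polynomial.eval_X]
  change _ = lengthSum G _ _
  rw [h, ← card_coloring_eq, ← chromaticPolynomial_eval, signedChromaticPolynomial]
  simp [Finset.card_univ]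

end Heap

/-- The first conjunct says that the Lyndon length is well defined on multilinear heaps. The
middle sum of the second runs over `k ≥ 1`, which needs a vertex: the empty heap has length `0`. -/
theorem corollary1p5 {I : Type*} [Finite I] [LinearOrder I] (G : SimpleGraph I) :
    (∀ E ∈ Heap.multilinear G, ∃! L : List (Heap G), E.IsLyndonFactorization L) ∧
    (Nonempty I →
      signedChromaticPolynomial G =
        ∑ᶠ (k : ℕ) (_ : 1 ≤ k),
          (((Heap.multilinear G).filter (fun E => E.lyndonLength = k)).card : Polynomial ℤ) *
            Polynomial.X ^ k) ∧
    signedChromaticPolynomial G =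
      ∑ E ∈ Heap.multilinear G, (Polynomial.X : Polynomial ℤ) ^ E.lyndonLength := by
  have : Fintype I := Fintype.ofFinite I
  refine ⟨fun E hE => ?_, fun hI => ?_, Heap.signedChromaticPolynomial_eq_sum⟩
  · rw [Heap.multilinear_eq_supportedOn, Heap.mem_supportedOn] at hE
    exact hE.1.existsUnique_isLyndonFactorization
  -- With a vertex present, at least one factor can be split off, so restricting the sum to `k ≥ 1`
  -- loses nothing.
  · have hpos : ∀ E ∈ Heap.multilinear G, 1 ≤ E.lyndonLength := by
      intro E hE
      rw [Heap.multilinear_eq_supportedOn, Heap.mem_supportedOn] at hE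
      rw [hE.1.lyndonLength_initPart (hE.2 ▸ Finset.univ_nonempty)]
      omega
    rw [Heap.signedChromaticPolynomial_eq_sum]
    have hmaps : ∀ E ∈ Heap.multilinear G,
        E.lyndonLength ∈ (Heap.multilinear G).image Heap.lyndonLength :=
      fun E hE => Finset.mem_image_of_mem _ hE
    simp only [← Set.mem_Ici]
    rw [finsum_mem_eq_sum_of_inter_support_eq (s := Set.Ici 1) _
      (t := (Heap.multilinear G).image Heap.lyndonLength),
      ← Finset.sum_fiberwise_of_maps_to hmaps]
    · refine Finset.sum_congr rfl fun k _ => ?_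
      rw [← nsmul_eq_mul, ← Finset.sum_const]
      exact Finset.sum_congr rfl fun E hE => by rw [(Finset.mem_filter.1 hE).2]
    · ext k
      simp only [Set.mem_inter_iff, Finset.mem_coe, Finset.mem_image, Function.mem_support]
      refine and_congr_left fun hk => ⟨fun _ => ?_, ?_⟩
      · by_contra hcon
        refine hk ?_
        rw [Finset.filter_eq_empty_iff.2 fun E hE h => hcon ⟨E, hE, h⟩]
        simp
      · rintro ⟨E, hE, rfl⟩
        exact hpos E hE
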